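/- **Reverse Shannon theorem under Rényi divergence.** Let $\mathcal X,\mathcal Y$ be finite non-empty alphabets and let $\mathcal W:\mathcal X\to\mathcal Y$ be a discrete memoryless channel with transition probabilities $\mathcal W(y|x)$. Write $\mathcal P(\cdot)$ for the set of probability distributions on an alphabet, $\log$ for the logarithm to base $2$, $(P\cdot\mathcal W)(x,y)=P(x)\mathcal W(y|x)$, and $\mathcal W^{\times n}$ for $n$ independent uses of $\mathcal W$. For $\alpha\in[0,\infty]$ the Rényi divergence is $D_\alpha(P\|Q)=-\log F_\alpha(P,Q)\in[0,\infty]$, where $F_\alpha(P,Q)=\big(\sum_x P(x)^\alpha Q(x)^{1-\alpha}\big)^{1/(1-\alpha)}$ for $\alpha\in(0,1)\cup(1,\infty)$ (with $\tfrac00=0$ and $\tfrac a0=\infty$ for $a>0$ when $\alpha>1$), $F_0(P,Q)=\sum_{x:P(x)>0}Q(x)$, $F_1(P,Q)=\prod_{x:P(x)>0}(Q(x)/P(x))^{P(x)}$, and $F_\infty(P,Q)=\min_{x:P(x)>0}Q(x)/P(x)$. The order-$\alpha$ Rényi capacity and the Shannon capacity are $$I_\alpha(\mathcal W)=\max_{P\in\mathcal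 P(\mathcal X)}\ \min_{Q\in\mathcal P(\mathcal Y)}D_\alpha(P\cdot\mathcal W\,\|\,P\times Q),\qquad I(\mathcal W)=\max_{P\in\mathcal P(\mathcal X)}D_1\big(P\cdot\mathcal W\,\|\,P\times \mathcal W(P)\big),$$ where $\mathcal W(P)=\sum_xP(x)\mathcal W(\cdot|x)$ is the output distribution. For $c\ge 0$ let $\mathcal A(\mathcal W,c)$ be the set of channels $\mathcal N:\mathcal X\to\mathcal Y$ of the form $$\mathcal N(y|x)=\sum_{k\in\mathcal K}\sum_{j=1}^{N}P_K(k)\,\mathcal E(j|x,k)\,\mathcal D(y|j,k),$$ where $N\ge1$ is an integer with $\log N\le c$, $P_K$ is a probability distribution (the shared randomness) on a finite alphabet $\mathcal K$ of arbitrary size, and $\mathcal E:\mathcal X\times\mathcal K\to\{1,\dots,N\}$ and $\mathcal D:\{1,\dots,N\}\times\mathcal K\to\mathcal Y$ are stochastic maps. Put $$\mathsf D_\alpha(\mathcal W,c)=\inf_{\mathcal N\in\mathcal A(\mathcal W,c)}\ \max_{P\in\mathcal P(\mathcal X)}D_\alpha(P\cdot\mathcal W\,\|\,P\cdot\mathcal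 N),$$ and define the $\alpha$-Rényi simulation rate, over sequences $(c_n)_{n\ge1}$ of nonnegative reals, by $$R^{(\alpha)}_{\mathrm{RST}}(\mathcal W)=\inf\Big\{\limsup_{n\to\infty}\frac{c_n}{n}\ \Big|\ \limsup_{n\to\infty}\mathsf D_\alpha(\mathcal W^{\times n},c_n)=0\Big\}.$$ Then $$R^{(\alpha)}_{\mathrm{RST}}(\mathcal W)=\begin{cases}I(\mathcal W),&\alpha\in(0,1],\\ I_\alpha(\mathcal W),&\alpha\in\{0\}\cup(1,\infty].\end{cases}$$ -/

import Mathlib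

open scoped ENNReal

noncomputable section

namespace ReverseShannon

/-- The order-`α` fidelity `F_α(P, Q)`, `α ∈ [0, ∞]`, of two nonnegative vectors on a finite
alphabet. In `ℝ≥0∞` we have `0 ^ s = ∞` for `s < 0` and `0 * ∞ = 0`, so that for `α > 1` a letter
with `P x = 0` contributes `0` and a letter with `Q x = 0 < P x` contributes `∞` to the sum.
In the product for `α = 1` a letter with `P x = 0` contributes the factor `1`. -/
def fidelity {A : Type*} [Fintype A] (α : ℝ≥0∞) (P Q : A → ℝ≥0∞) : ℝ≥0∞ :=
  if α = 0 then ∑ x, (Function.support P).indicator Q x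
  else if α = 1 then ∏ x, (Q x / P x) ^ (P x).toReal
  else if α = ∞ then ⨅ x ∈ Function.support P, Q x / P x
  else (∑ x, P x ^ α.toReal * Q x ^ (1 - α.toReal)) ^ (1 / (1 - α.toReal))

/-- The binary logarithm on `[0, ∞]`, with `log₂ 0 = -∞` and `log₂ ∞ = ∞`. -/
def log₂ (x : ℝ≥0∞) : EReal := ENNReal.log x / ((Real.log 2 : ℝ) : EReal)

/-- The order-`α` Rényi divergence `D_α(P ‖ Q) = -log₂ F_α(P, Q)`. -/
def renyiDiv {A : Type*} [Fintype A] (α : ℝ≥0∞) (P Q : A → ℝ≥0∞) : EReal :=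
  -log₂ (fidelity α P Q)

/-- A channel with input alphabet `X` and output alphabet `Y`: `W x y` is the probability
`W(y|x)` of receiving `y` when `x` is sent. -/
abbrev Channel (X Y : Type*) := X → PMF Y

variable {X Y : Type*}

/-- The joint distribution `P · W` of input and output. -/
def joint (P : PMF X) (W : Channel X Y) : X × Y → ℝ≥0∞ := fun p => P p.1 * W p.1 p.2

/-- The product distribution `P × Q`. -/
def prodDist (P : PMF X) (Q : PMF Y) : X × Y → ℝ≥0∞ := fun p => P p.1 * Q p.2

/-- The Rényi mutual information `I_α(X : Y)` of the joint distribution `P · W`. -/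
def renyiMutualInfo [Fintype X] [Fintype Y] (α : ℝ≥0∞) (P : PMF X) (W : Channel X Y) : EReal :=
  ⨅ Q : PMF Y, renyiDiv α (joint P W) (prodDist P Q)

/-- The order-`α` Rényi capacity `I_α(W)`. -/
def renyiCapacity [Fintype X] [Fintype Y] (α : ℝ≥0∞) (W : Channel X Y) : EReal :=
  ⨆ P : PMF X, renyiMutualInfo α P W

/-- The mutual information `I(X : Y) = D(P_XY ‖ P_X × P_Y)` of the joint distribution `P · W`;
its output marginal is `P.bind W`. -/
def mutualInfo [Fintype X] [Fintype Y] (P : PMF X) (W : Channel X Y) : EReal :=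
  renyiDiv 1 (joint P W) (prodDist P (P.bind W))

/-- The Shannon capacity `I(W)`. -/
def shannonCapacity [Fintype X] [Fintype Y] (W : Channel X Y) : EReal :=
  ⨆ P : PMF X, mutualInfo P W

/-- `n` independent uses `W^{×n}` of the channel `W`. -/
def Channel.power [Fintype Y] (W : Channel X Y) (n : ℕ) : Channel (Fin n → X) (Fin n → Y) :=
  fun x => PMF.ofFintype (fun y => ∏ i, W (x i) (y i)) (by
    rw [← Fintype.prod_sum]
    exact Finset.prod_eq_one fun i _ => by
      simpa only [tsum_fintype] using (W (x i)).tsum_coe)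

/-- The channels `X → Y` that can be realized with at most `c` bits of communication and shared
randomness `K` of arbitrary finite size: the sender encodes `(x, k)` into a message `j` out of `N`,
`log₂ N ≤ c`, and the receiver decodes `(j, k)` into `y`, both by local stochastic maps. -/
def simulations (X Y : Type*) (c : ℝ) : Set (Channel X Y) :=
  {M | ∃ N : ℕ, 1 ≤ N ∧ Real.logb 2 N ≤ c ∧
    ∃ (K : Type) (_ : Fintype K) (PK : PMF K)
      (E : Channel (X × K) (Fin N)) (D : Channel (Fin N × K) Y),
      ∀ x y, M x y = ∑ k, ∑ j, PK k * E (x, k) j * D (j, k) y}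

/-- The divergence `D_α(W, M)` between two channels, in the worst case over input distributions. -/
def channelDiv [Fintype X] [Fintype Y] (α : ℝ≥0∞) (W M : Channel X Y) : EReal :=
  ⨆ P : PMF X, renyiDiv α (joint P W) (joint P M)

/-- The optimal performance of simulating `W` with at most `c` bits of communication. -/
def simPerformance [Fintype X] [Fintype Y] (α : ℝ≥0∞) (W : Channel X Y) (c : ℝ) : EReal :=
  ⨅ M ∈ simulations X Y c, channelDiv α W M

/-- The `α`-Rényi simulation rate: the infimum of `limsup c_n / n` over all sequences of
nonnegative communication costs for which the optimal performance vanishes asymptotically. -/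
def renyiSimulationRate [Fintype X] [Fintype Y] (α : ℝ≥0∞) (W : Channel X Y) : EReal :=
  sInf {R | ∃ c : ℕ → ℝ, (∀ n, 0 ≤ c n) ∧
    Filter.limsup (fun n => simPerformance α (W.power n) (c n)) Filter.atTop = 0 ∧
    R = Filter.limsup (fun n => ((c n / n : ℝ) : EReal)) Filter.atTop}

end ReverseShannon

end

/-!
Converse: a channel `M` simulated with `c` bits satisfies `M(y|x) ≤ 2^c Q(y)` for one output
distribution `Q`, so `F_α(P·W, P·M)` is at most `2^c F_α(P·W, P × Q) ≤ 2^(c - I_α(P, W))`. By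
Sibson's closed formula the Rényi mutual information is additive on i.i.d. inputs, hence an
asymptotically perfect simulation of `W^n` needs at least `n I_α(W)` bits. For `α < 1`, Hölder's
inequality between the orders `α < b < 1` bounds `F_α` by a positive power of `F_b`, whose exponent
does not depend on `n`, and `b → 1` gives the Shannon capacity; `α = 1` follows by monotonicity in
the order.

Achievability: by Sion's minimax theorem, for `t > I_α(W)` a single `Q` satisfies
`D_α(W_x ‖ Q) < t` for every input `x`. Replace `W^n` by a channel `L` with `L ≤ 2^(1 + n t) Q^n`
and fidelity to `W^n` tending to `1`: `W^n` itself if `α = ∞`, `Q^n` conditioned on the support of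
`W^n_x` if `α = 0`, and `W^n` truncated at `2^(n t) Q^n` if `1 < α < ∞`. Rejection sampling from
`m` shared samples of `Q^n` simulates such an `L`, up to the factor `1 - (1 - 2^(-(1 + n t)))^m`,
by communicating the index of the accepted sample. For `α ≤ 1` one passes to an order slightly
above `1`.
-/

noncomputable section

namespace ReverseShannon

open Filter Topology

section RpowInequalities

variable {ι : Type*} [Fintype ι]

theorem rpow_le_rpow_of_nonpos {x y : ℝ≥0∞} {z : ℝ} (h : x ≤ y) (hz : z ≤ 0) :
    y ^ z ≤ x ^ z := by
  have := ENNReal.inv_le_inv.2 (ENNReal.rpow_le_rpow h (neg_nonneg.2 hz))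
  rwa [← ENNReal.rpow_neg, ← ENNReal.rpow_neg, neg_neg] at this

theorem rpow_finset_sum {κ : Type*} (s : Finset κ) {c : ℝ≥0∞} (hc : c ≠ 0) (hc' : c ≠ ∞)
    (f : κ → ℝ) : c ^ (∑ i ∈ s, f i) = ∏ i ∈ s, c ^ f i := by
  lift c to NNReal using hc'
  have hc0 : c ≠ 0 := by exact_mod_cast hc
  simp_rw [← ENNReal.coe_rpow_of_ne_zero hc0, ← ENNReal.ofNNReal_finsetProd]
  congr 1
  ext
  push_cast
  exact Real.rpow_sum_of_pos (by positivity) f s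

theorem ne_top_of_sum_eq_one {w : ι → ℝ≥0∞} (hw : ∑ i, w i = 1) (i : ι) : w i ≠ ∞ :=
  ENNReal.ne_top_of_tsum_ne_top (by simp [tsum_fintype, hw]) i

theorem sum_toReal_eq_one {w : ι → ℝ≥0∞} (hw : ∑ i, w i = 1) : ∑ i, (w i).toReal = 1 := by
  rw [← ENNReal.toReal_sum fun i _ => ne_top_of_sum_eq_one hw i, hw, ENNReal.toReal_one]

theorem sum_pmf_coe (P : PMF ι) : ∑ i, P i = 1 := by
  rw [← tsum_fintype (L := .unconditional _), P.tsum_coe]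

theorem prod_rpow_toReal_le_sum_mul {w z : ι → ℝ≥0∞} (hw : ∑ i, w i = 1) :
    ∏ i, z i ^ (w i).toReal ≤ ∑ i, w i * z i := by
  have hwt := ne_top_of_sum_eq_one hw
  by_cases h : ∃ i, w i ≠ 0 ∧ z i = ∞
  · obtain ⟨i, hi, hi'⟩ := h
    have : ∑ i, w i * z i = ∞ :=
      ENNReal.sum_eq_top.2 ⟨i, Finset.mem_univ _, by rw [hi', ENNReal.mul_top hi]⟩
    exact this ▸ le_top
  push Not at h
  have hw1 : ∑ i, (w i).toNNReal = 1 := by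
    rw [← ENNReal.toNNReal_sum fun i _ => hwt i, hw, ENNReal.toNNReal_one]
  have key := NNReal.geom_mean_le_arith_mean_weighted Finset.univ (fun i => (w i).toNNReal)
    (fun i => (z i).toNNReal) hw1
  rw [← ENNReal.coe_le_coe, ENNReal.ofNNReal_finsetProd, ENNReal.ofNNReal_finsetSum] at key
  refine le_trans (Finset.prod_congr rfl fun i _ => ?_).le
    (key.trans (Finset.sum_le_sum fun i _ => ?_))
  · by_cases hi : w i = 0
    · simp [hi]
    · rw [ENNReal.coe_rpow_of_nonneg _ (NNReal.coe_nonneg _), ENNReal.coe_toNNReal (h i hi)]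
      rfl
  · rw [ENNReal.coe_mul, ENNReal.coe_toNNReal (hwt i)]
    exact mul_le_mul_right ENNReal.coe_toNNReal_le_self _

theorem sum_rpow_mul_rpow_le (f g : ι → ℝ≥0∞) {l : ℝ} (hl : 0 < l) (hl' : l < 1) :
    ∑ i, f i ^ l * g i ^ (1 - l) ≤ (∑ i, f i) ^ l * (∑ i, g i) ^ (1 - l) := by
  have hl1 : 0 < 1 - l := sub_pos.2 hl'
  have hconj : (l⁻¹).HolderConjugate (1 - l)⁻¹ :=
    Real.holderConjugate_iff.2 ⟨(one_lt_inv₀ hl).2 hl', by simp⟩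
  simpa [← ENNReal.rpow_mul, hl.ne', hl1.ne', mul_inv_cancel₀] using
    ENNReal.inner_le_Lp_mul_Lq Finset.univ (fun i => f i ^ l) (fun i => g i ^ (1 - l)) hconj

end RpowInequalities

section Fidelity

variable {A : Type*} [Fintype A]

/-- The Hellinger sum of real order `a`; for `0 < a ≠ 1` the fidelity `F_a` is its power with
exponent `1 / (1 - a)`. -/
def hellingerSum (a : ℝ) (P Q : A → ℝ≥0∞) : ℝ≥0∞ := ∑ x, P x ^ a * Q x ^ (1 - a)

theorem fidelity_zero (P Q : A → ℝ≥0∞) :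
    fidelity 0 P Q = ∑ x, (Function.support P).indicator Q x := by
  simp [fidelity]

theorem fidelity_one (P Q : A → ℝ≥0∞) :
    fidelity 1 P Q = ∏ x, (Q x / P x) ^ (P x).toReal := by
  simp [fidelity]

theorem fidelity_top (P Q : A → ℝ≥0∞) :
    fidelity ∞ P Q = ⨅ x ∈ Function.support P, Q x / P x := by
  simp [fidelity]

theorem fidelity_ofReal {a : ℝ} (ha : 0 < a) (ha' : a ≠ 1) (P Q : A → ℝ≥0∞) :
    fidelity (ENNReal.ofReal a) P Q = hellingerSum a P Q ^ (1 / (1 - a)) := by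
  have h0 : ENNReal.ofReal a ≠ 0 := by simpa using ha
  have h1 : ENNReal.ofReal a ≠ 1 := by simpa using ha'
  rw [fidelity, if_neg h0, if_neg h1, if_neg ENNReal.ofReal_ne_top, ENNReal.toReal_ofReal ha.le,
    hellingerSum]

theorem order_cases (α : ℝ≥0∞) :
    α = 0 ∨ α = 1 ∨ α = ∞ ∨ ∃ a : ℝ, 0 < a ∧ a ≠ 1 ∧ α = ENNReal.ofReal a := by
  by_cases h0 : α = 0
  · exact .inl h0
  by_cases h1 : α = 1
  · exact .inr (.inl h1)
  by_cases ht : α = ∞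
  · exact .inr (.inr (.inl ht))
  exact .inr (.inr (.inr ⟨α.toReal, ENNReal.toReal_pos h0 ht,
    fun h => h1 ((ENNReal.toReal_eq_one_iff α).1 h), (ENNReal.ofReal_toReal ht).symm⟩))

theorem fidelity_mono_right (α : ℝ≥0∞) (P : A → ℝ≥0∞) {Q Q' : A → ℝ≥0∞} (h : ∀ x, Q x ≤ Q' x) :
    fidelity α P Q ≤ fidelity α P Q' := by
  rcases order_cases α with rfl | rfl | rfl | ⟨a, ha, ha', rfl⟩
  · simp only [fidelity_zero]
    exact Finset.sum_le_sum fun x _ => Set.indicator_le_indicator (h x)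
  · simp only [fidelity_one]
    exact Finset.prod_le_prod' fun x _ =>
      ENNReal.rpow_le_rpow (ENNReal.div_le_div_right (h x) _) ENNReal.toReal_nonneg
  · simp only [fidelity_top]
    exact iInf₂_mono fun x _ => ENNReal.div_le_div_right (h x) _
  · simp only [fidelity_ofReal ha ha', hellingerSum]
    rcases lt_or_gt_of_ne ha' with h1 | h1
    · have : 0 < 1 - a := sub_pos.2 h1
      gcongr with x
      exact h x
    · have : 1 - a < 0 := sub_neg.2 h1
      exact rpow_le_rpow_of_nonpos (Finset.sum_le_sum fun x _ =>
        mul_le_mul_right (rpow_le_rpow_of_nonpos (h x) this.le) _) (one_div_neg.2 this).le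

theorem hellingerSum_const_mul_right (a : ℝ) (P Q : A → ℝ≥0∞) {c : ℝ≥0∞} (hc : c ≠ 0)
    (hc' : c ≠ ∞) : hellingerSum a P (fun x => c * Q x) = c ^ (1 - a) * hellingerSum a P Q := by
  simp only [hellingerSum, Finset.mul_sum]
  refine Finset.sum_congr rfl fun x _ => ?_
  rw [ENNReal.mul_rpow_eq_ite, if_neg (by simp [hc, hc']), mul_left_comm]

theorem fidelity_const_mul_right (α : ℝ≥0∞) {P : A → ℝ≥0∞} (hP : ∑ x, P x = 1) (Q : A → ℝ≥0∞)
    {c : ℝ≥0∞} (hc : c ≠ 0) (hc' : c ≠ ∞) :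
    fidelity α P (fun x => c * Q x) = c * fidelity α P Q := by
  rcases order_cases α with rfl | rfl | rfl | ⟨a, ha, ha', rfl⟩
  · simp only [fidelity_zero, Finset.mul_sum]
    refine Finset.sum_congr rfl fun x _ => ?_
    by_cases hx : x ∈ Function.support P <;> simp [hx]
  · simp only [fidelity_one, mul_div_assoc]
    simp_rw [ENNReal.mul_rpow_of_nonneg _ _ ENNReal.toReal_nonneg]
    rw [Finset.prod_mul_distrib, ← rpow_finset_sum _ hc hc', sum_toReal_eq_one hP,
      ENNReal.rpow_one]
  · simp only [fidelity_top, mul_div_assoc]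
    rw [ENNReal.mul_iInf_of_ne hc hc']
    refine iInf_congr fun x => ?_
    by_cases hx : x ∈ Function.support P
    · simp [hx]
    · simp [hx, ENNReal.mul_top hc]
  · have hd : c ^ (1 - a) ≠ 0 := (ENNReal.rpow_pos (pos_iff_ne_zero.2 hc) hc').ne'
    have hd' : c ^ (1 - a) ≠ ∞ := ENNReal.rpow_ne_top_of_ne_zero hc hc'
    rw [fidelity_ofReal ha ha', fidelity_ofReal ha ha', hellingerSum_const_mul_right a P Q hc hc',
      ENNReal.mul_rpow_eq_ite, if_neg (by simp [hd, hd']), ← ENNReal.rpow_mul,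
      mul_one_div_cancel (sub_ne_zero.2 ha'.symm), ENNReal.rpow_one]

theorem mul_div_rpow_one_sub {p q : ℝ≥0∞} (hp : p ≠ ∞) (hq : q ≠ ∞) {a : ℝ} (ha : 0 < a) :
    p * (q / p) ^ (1 - a) = p ^ a * q ^ (1 - a) := by
  by_cases hp0 : p = 0
  · simp [hp0, ENNReal.zero_rpow_of_pos ha]
  · rw [div_eq_mul_inv, ENNReal.mul_rpow_of_ne_top hq (by simpa using hp0), ENNReal.inv_rpow,
      ← ENNReal.rpow_neg, mul_left_comm, mul_comm (q ^ _)]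
    nth_rw 1 [← ENNReal.rpow_one p]
    rw [← ENNReal.rpow_add _ _ hp0 hp]
    ring_nf

theorem fidelity_one_rpow_le_hellingerSum {P Q : A → ℝ≥0∞} (hP : ∑ x, P x = 1)
    (hQ : ∀ x, Q x ≠ ∞) {a : ℝ} (ha : 0 < a) :
    fidelity 1 P Q ^ (1 - a) ≤ hellingerSum a P Q := by
  have hfactor (x : A) : (Q x / P x) ^ (P x).toReal ≠ ∞ := by
    by_cases hx : P x = 0
    · simp [hx]
    · exact ENNReal.rpow_ne_top_of_nonneg ENNReal.toReal_nonneg (ENNReal.div_ne_top (hQ x) hx)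
  calc fidelity 1 P Q ^ (1 - a)
      = ∏ x, ((Q x / P x) ^ (1 - a)) ^ (P x).toReal := by
        rw [fidelity_one, ← ENNReal.prod_rpow_of_ne_top fun x _ => hfactor x]
        simp_rw [← ENNReal.rpow_mul, mul_comm]
    _ ≤ ∑ x, P x * (Q x / P x) ^ (1 - a) := prod_rpow_toReal_le_sum_mul hP
    _ = hellingerSum a P Q := Finset.sum_congr rfl fun x _ =>
        mul_div_rpow_one_sub (ne_top_of_sum_eq_one hP x) (hQ x) ha

theorem fidelity_one_le_of_le_one {P Q : A → ℝ≥0∞} (hP : ∑ x, P x = 1) (hQ : ∀ x, Q x ≠ ∞)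
    {α : ℝ≥0∞} (hα : 0 < α) (hα' : α ≤ 1) : fidelity 1 P Q ≤ fidelity α P Q := by
  rcases order_cases α with rfl | rfl | rfl | ⟨a, ha, ha', rfl⟩
  · exact absurd hα (lt_irrefl _)
  · exact le_rfl
  · exact absurd hα' (by simp)
  · have ha1 : a < 1 := lt_of_le_of_ne (by simpa using hα') ha'
    rw [fidelity_ofReal ha ha', one_div, ENNReal.le_rpow_inv_iff (sub_pos.2 ha1)]
    exact fidelity_one_rpow_le_hellingerSum hP hQ ha

theorem fidelity_ofReal_le_fidelity_one {P Q : A → ℝ≥0∞} (hP : ∑ x, P x = 1) (hQ : ∀ x, Q x ≠ ∞)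
    {a : ℝ} (ha : 1 < a) : fidelity (ENNReal.ofReal a) P Q ≤ fidelity 1 P Q := by
  have ha0 : 0 < a := one_pos.trans ha
  have hexp : 1 - a < 0 := sub_neg.2 ha
  calc fidelity (ENNReal.ofReal a) P Q
      ≤ (fidelity 1 P Q ^ (1 - a)) ^ (1 / (1 - a)) := by
        rw [fidelity_ofReal ha0 ha.ne']
        exact rpow_le_rpow_of_nonpos (fidelity_one_rpow_le_hellingerSum hP hQ ha0)
          (one_div_neg.2 hexp).le
    _ = fidelity 1 P Q := by
        rw [← ENNReal.rpow_mul, mul_one_div_cancel hexp.ne, ENNReal.rpow_one]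

theorem fidelity_top_mul_le {P Q : A → ℝ≥0∞} {x : A} (hx : P x ≠ ∞) :
    fidelity ∞ P Q * P x ≤ Q x := by
  by_cases hx0 : P x = 0
  · simp [hx0]
  · rw [← ENNReal.le_div_iff_mul_le (.inl hx0) (.inl hx), fidelity_top]
    exact iInf₂_le x hx0

theorem fidelity_le_one (α : ℝ≥0∞) {P Q : A → ℝ≥0∞} (hP : ∑ x, P x = 1) (hQ : ∑ x, Q x = 1) :
    fidelity α P Q ≤ 1 := by
  have h1 : fidelity 1 P Q ≤ 1 := by
    rw [fidelity_one, ← hQ]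
    exact (prod_rpow_toReal_le_sum_mul hP).trans
      (Finset.sum_le_sum fun x _ => ENNReal.mul_div_le)
  rcases order_cases α with rfl | rfl | rfl | ⟨a, ha, ha', rfl⟩
  · rw [fidelity_zero, ← hQ]
    exact Finset.sum_le_sum fun x _ => Set.indicator_le_self _ _ x
  · exact h1
  · calc fidelity ∞ P Q = ∑ x, fidelity ∞ P Q * P x := by rw [← Finset.mul_sum, hP, mul_one]
      _ ≤ ∑ x, Q x :=
          Finset.sum_le_sum fun x _ => fidelity_top_mul_le (ne_top_of_sum_eq_one hP x)
      _ = 1 := hQ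
  · rcases lt_or_gt_of_ne ha' with h | h
    · rw [fidelity_ofReal ha ha']
      refine ENNReal.rpow_le_one ?_ (one_div_pos.2 (sub_pos.2 h)).le
      simpa [hellingerSum, hP, hQ] using sum_rpow_mul_rpow_le P Q ha h
    · exact (fidelity_ofReal_le_fidelity_one hP (ne_top_of_sum_eq_one hQ) h).trans h1

theorem hellingerSum_le_rpow_of_lt {P Q : A → ℝ≥0∞} (hQ : ∑ x, Q x = 1) {a b : ℝ} (ha : 0 < a)
    (hab : a < b) (hb : b ≤ 1) : hellingerSum a P Q ≤ hellingerSum b P Q ^ (a / b) := by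
  have hb0 : 0 < b := ha.trans hab
  have hl : 0 < a / b := div_pos ha hb0
  have hl' : a / b < 1 := (div_lt_one hb0).2 hab
  have hsplit (x : A) : P x ^ a * Q x ^ (1 - a) =
      (P x ^ b * Q x ^ (1 - b)) ^ (a / b) * Q x ^ (1 - a / b) := by
    rw [ENNReal.mul_rpow_of_nonneg _ _ hl.le, ← ENNReal.rpow_mul, ← ENNReal.rpow_mul, mul_assoc,
      ← ENNReal.rpow_add_of_nonneg _ _ (mul_nonneg (sub_nonneg.2 hb) hl.le) (sub_nonneg.2 hl'.le)]
    congr 2 <;> field_simp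
    ring
  calc hellingerSum a P Q
      = ∑ x, (P x ^ b * Q x ^ (1 - b)) ^ (a / b) * Q x ^ (1 - a / b) :=
        Finset.sum_congr rfl fun x _ => hsplit x
    _ ≤ hellingerSum b P Q ^ (a / b) * (∑ x, Q x) ^ (1 - a / b) :=
        sum_rpow_mul_rpow_le _ _ hl hl'
    _ = hellingerSum b P Q ^ (a / b) := by rw [hQ, ENNReal.one_rpow, mul_one]

theorem fidelity_ofReal_le_rpow_of_lt {P Q : A → ℝ≥0∞} (hQ : ∑ x, Q x = 1) {a b : ℝ}
    (ha : 0 < a) (hab : a < b) (hb : b < 1) :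
    fidelity (ENNReal.ofReal a) P Q ≤
      fidelity (ENNReal.ofReal b) P Q ^ (a * (1 - b) / (b * (1 - a))) := by
  have hb0 : 0 < b := ha.trans hab
  have ha1 : 0 < 1 - a := sub_pos.2 (hab.trans hb)
  have hb1 : 0 < 1 - b := sub_pos.2 hb
  calc fidelity (ENNReal.ofReal a) P Q
      ≤ (hellingerSum b P Q ^ (a / b)) ^ (1 / (1 - a)) := by
        rw [fidelity_ofReal ha (hab.trans hb).ne]
        exact ENNReal.rpow_le_rpow (hellingerSum_le_rpow_of_lt hQ ha hab hb.le)
          (one_div_pos.2 ha1).le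
    _ = fidelity (ENNReal.ofReal b) P Q ^ (a * (1 - b) / (b * (1 - a))) := by
        rw [fidelity_ofReal hb0 hb.ne, ← ENNReal.rpow_mul, ← ENNReal.rpow_mul]
        congr 1
        field_simp

end Fidelity

section Logarithm

variable {A : Type*} [Fintype A] {α : ℝ≥0∞} {P Q : A → ℝ≥0∞} {t : ℝ}

theorem log₂_two_rpow (t : ℝ) : log₂ (2 ^ t) = t := by
  have h2 : Real.log 2 ≠ 0 := (Real.log_pos one_lt_two).ne'
  have hlog : ENNReal.log 2 = (Real.log 2 : ℝ) := by
    rw [← ENNReal.ofReal_ofNat, ENNReal.log_ofReal_of_pos two_pos]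
  rw [log₂, ENNReal.log_rpow, hlog, ← EReal.coe_mul, ← EReal.coe_div,
    mul_div_cancel_right₀ _ h2]

theorem log₂_strictMono : StrictMono log₂ := fun _ _ h =>
  EReal.div_lt_div_right_of_pos (by exact_mod_cast Real.log_pos one_lt_two) (EReal.coe_ne_top _)
    (ENNReal.log_lt_log h)

theorem renyiDiv_le_iff : renyiDiv α P Q ≤ t ↔ 2 ^ (-t) ≤ fidelity α P Q := by
  rw [renyiDiv, EReal.neg_le, ← log₂_strictMono.le_iff_le, log₂_two_rpow, EReal.coe_neg]

theorem le_renyiDiv_iff : t ≤ renyiDiv α P Q ↔ fidelity α P Q ≤ 2 ^ (-t) := by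
  rw [renyiDiv, EReal.le_neg, ← log₂_strictMono.le_iff_le, log₂_two_rpow, EReal.coe_neg]

theorem renyiDiv_lt_iff : renyiDiv α P Q < t ↔ 2 ^ (-t) < fidelity α P Q := by
  rw [← not_le, le_renyiDiv_iff, not_le]

theorem lt_renyiDiv_iff : t < renyiDiv α P Q ↔ fidelity α P Q < 2 ^ (-t) := by
  rw [← not_le, renyiDiv_le_iff, not_le]

theorem renyiDiv_nonneg (α : ℝ≥0∞) (hP : ∑ x, P x = 1) (hQ : ∑ x, Q x = 1) :
    0 ≤ renyiDiv α P Q := by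
  refine EReal.coe_zero.symm.trans_le (le_renyiDiv_iff.2 ?_)
  simpa using fidelity_le_one α hP hQ

theorem two_rpow_pos (t : ℝ) : (0 : ℝ≥0∞) < 2 ^ t :=
  ENNReal.rpow_pos two_pos ENNReal.ofNat_ne_top

theorem two_rpow_ne_top (t : ℝ) : (2 : ℝ≥0∞) ^ t ≠ ∞ :=
  ENNReal.rpow_ne_top_of_ne_zero two_ne_zero ENNReal.ofNat_ne_top

theorem two_rpow_eq_ofReal (t : ℝ) : (2 : ℝ≥0∞) ^ t = ENNReal.ofReal (2 ^ t) := by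
  rw [← ENNReal.ofReal_rpow_of_pos two_pos, ENNReal.ofReal_ofNat]

theorem two_rpow_add (s t : ℝ) : (2 : ℝ≥0∞) ^ (s + t) = 2 ^ s * 2 ^ t :=
  ENNReal.rpow_add _ _ two_ne_zero ENNReal.ofNat_ne_top

end Logarithm

section Joint

theorem prodDist_eq_joint {X Y : Type*} (P : PMF X) (Q : PMF Y) :
    prodDist P Q = joint P fun _ => Q := rfl

theorem joint_ne_top {X Y : Type*} (P : PMF X) (W : Channel X Y) (p : X × Y) : joint P W p ≠ ∞ :=
  ENNReal.mul_ne_top (P.apply_ne_top _) ((W _).apply_ne_top _)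

variable {X Y : Type*} [Fintype X] [Fintype Y]

theorem sum_joint (P : PMF X) (W : Channel X Y) : ∑ p, joint P W p = 1 := by
  simp only [joint, Fintype.sum_prod_type, ← Finset.mul_sum, sum_pmf_coe, mul_one]

theorem hellingerSum_joint (P : PMF X) (W M : Channel X Y) {a : ℝ} (ha : 0 < a) :
    hellingerSum a (joint P W) (joint P M) = ∑ x, P x * hellingerSum a (W x) (M x) := by
  simp only [hellingerSum, joint, Fintype.sum_prod_type, Finset.mul_sum]
  refine Finset.sum_congr rfl fun x _ => Finset.sum_congr rfl fun y _ => ?_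
  by_cases hx : P x = 0
  · simp [hx, ENNReal.zero_rpow_of_pos ha]
  · have hxt := P.apply_ne_top x
    rw [ENNReal.mul_rpow_of_ne_top hxt ((W x).apply_ne_top y),
      ENNReal.mul_rpow_of_ne_top hxt ((M x).apply_ne_top y), mul_mul_mul_comm,
      ← ENNReal.rpow_add _ _ hx hxt, add_sub_cancel, ENNReal.rpow_one]

theorem fidelity_zero_joint (P : PMF X) (W M : Channel X Y) :
    fidelity 0 (joint P W) (joint P M) = ∑ x, P x * fidelity 0 (W x) (M x) := by
  simp only [fidelity_zero, Fintype.sum_prod_type, Finset.mul_sum]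
  refine Finset.sum_congr rfl fun x _ => Finset.sum_congr rfl fun y _ => ?_
  by_cases hW : W x y = 0 <;> by_cases hP : P x = 0 <;> simp [joint, hW, hP]

theorem fidelity_top_joint_le (P : PMF X) (W M : Channel X Y) {x : X} (hx : P x ≠ 0) :
    fidelity ∞ (joint P W) (joint P M) ≤ fidelity ∞ (W x) (M x) := by
  simp only [fidelity_top]
  refine le_iInf₂ fun y hy => (iInf₂_le (x, y) (mul_ne_zero hx hy)).trans_eq ?_
  exact ENNReal.mul_div_mul_left _ _ hx (P.apply_ne_top x)

end Joint

section Products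

theorem Channel.power_apply {X Y : Type*} [Fintype Y] (W : Channel X Y) (n : ℕ) (x : Fin n → X)
    (y : Fin n → Y) : W.power n x y = ∏ i, W (x i) (y i) := rfl

variable {X : Type*} [Fintype X]

/-- The `n`-fold product of a probability distribution, encoded as a power of the channel whose
input alphabet is a single letter. -/
def iid (P : PMF X) (n : ℕ) : PMF (Fin n → X) :=
  Channel.power (fun _ : Unit => P) n fun _ => ()

theorem iid_apply (P : PMF X) (n : ℕ) (x : Fin n → X) : iid P n x = ∏ i, P (x i) := rfl

theorem fidelity_zero_pi {n : ℕ} (f g : Fin n → X → ℝ≥0∞) :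
    fidelity 0 (fun x : Fin n → X => ∏ i, f i (x i)) (fun x => ∏ i, g i (x i)) =
      ∏ i, fidelity 0 (f i) (g i) := by
  classical
  simp only [fidelity_zero, Fintype.prod_sum, Set.indicator_apply, Function.mem_support]
  refine Finset.sum_congr rfl fun x _ => ?_
  by_cases h : ∏ i, f i (x i) = 0
  · obtain ⟨i, hi, h0⟩ := Finset.prod_eq_zero_iff.1 h
    rw [if_neg (not_not.2 h), Finset.prod_eq_zero hi (if_neg (not_not.2 h0))]
  · rw [if_pos h]
    exact Finset.prod_congr rfl fun i hi => (if_pos (Finset.prod_ne_zero_iff.1 h i hi)).symm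

theorem hellingerSum_pi {n : ℕ} (f : Fin n → X → ℝ≥0∞) {g : Fin n → X → ℝ≥0∞}
    (hg : ∀ i x, g i x ≠ ∞) {a : ℝ} (ha : 0 < a) :
    hellingerSum a (fun x : Fin n → X => ∏ i, f i (x i)) (fun x => ∏ i, g i (x i)) =
      ∏ i, hellingerSum a (f i) (g i) := by
  simp only [hellingerSum, Fintype.prod_sum, Finset.prod_mul_distrib,
    ENNReal.prod_rpow_of_nonneg ha.le, ENNReal.prod_rpow_of_ne_top fun i _ => hg i _]

end Products

section MutualInformation

variable {X Y : Type*} [Fintype X]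

theorem sum_mul_rpow_ne_top {a : ℝ} (ha : 0 < a) (P : PMF X) (W : Channel X Y) (y : Y) :
    ∑ x, P x * W x y ^ a ≠ ∞ :=
  ENNReal.sum_ne_top.2 fun x _ => ENNReal.mul_ne_top (P.apply_ne_top x)
    (ENNReal.rpow_ne_top_of_nonneg ha.le ((W x).apply_ne_top y))

variable [Fintype Y]

/-- The sum `∑ y, (∑ x, P x * W x y ^ a) ^ (1 / a)` in Sibson's closed formula for the Rényi mutual
information of order `a`. -/
def sibsonSum (a : ℝ) (P : PMF X) (W : Channel X Y) : ℝ≥0∞ :=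
  ∑ y, (∑ x, P x * W x y ^ a) ^ (1 / a)

theorem sibsonSum_ne_top {a : ℝ} (ha : 0 < a) (P : PMF X) (W : Channel X Y) :
    sibsonSum a P W ≠ ∞ :=
  ENNReal.sum_ne_top.2 fun y _ => ENNReal.rpow_ne_top_of_nonneg (by positivity)
    (sum_mul_rpow_ne_top ha P W y)

theorem sibsonSum_ne_zero {a : ℝ} (ha : 0 < a) (P : PMF X) (W : Channel X Y) :
    sibsonSum a P W ≠ 0 := by
  obtain ⟨x, hx⟩ := P.support_nonempty
  obtain ⟨y, hy⟩ := (W x).support_nonempty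
  have hxy : P x * W x y ^ a ≠ 0 :=
    mul_ne_zero hx ((ENNReal.rpow_eq_zero_iff_of_pos ha).not.2 hy)
  have hy' : (∑ x, P x * W x y ^ a) ^ (1 / a) ≠ 0 := by
    rw [Ne, ENNReal.rpow_eq_zero_iff_of_pos (by positivity)]
    exact fun h => hxy (Finset.sum_eq_zero_iff.1 h x (Finset.mem_univ x))
  exact fun h => hy' (Finset.sum_eq_zero_iff.1 h y (Finset.mem_univ y))

-- Sibson's identity; the distribution `R` is the normalized summand of `sibsonSum`.
theorem exists_fidelity_prodDist_eq {a : ℝ} (ha : 0 < a) (ha' : a ≠ 1) (P : PMF X)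
    (W : Channel X Y) :
    ∃ R : PMF Y, ∀ Q : PMF Y, fidelity (ENNReal.ofReal a) (joint P W) (prodDist P Q) =
      sibsonSum a P W ^ (a / (1 - a)) * fidelity (ENNReal.ofReal a) R Q := by
  set S := sibsonSum a P W
  have h0 : S ≠ 0 := sibsonSum_ne_zero ha P W
  have ht : S ≠ ∞ := sibsonSum_ne_top ha P W
  let R : PMF Y := PMF.normalize (fun y => (∑ x, P x * W x y ^ a) ^ (1 / a))
    (by rwa [tsum_fintype]) (by rwa [tsum_fintype])
  have hR (y : Y) : ∑ x, P x * W x y ^ a = S ^ a * R y ^ a := by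
    rw [← ENNReal.mul_rpow_of_nonneg _ _ ha.le, PMF.normalize_apply, tsum_fintype, mul_comm,
      mul_assoc]
    change _ = (_ * (S⁻¹ * S)) ^ a
    rw [ENNReal.inv_mul_cancel h0 ht, mul_one, ← ENNReal.rpow_mul, one_div_mul_cancel ha.ne',
      ENNReal.rpow_one]
  have hsum (Q : PMF Y) : hellingerSum a (joint P W) (prodDist P Q) =
      S ^ a * hellingerSum a R Q := by
    rw [prodDist_eq_joint, hellingerSum_joint P W _ ha]
    simp only [hellingerSum, Finset.mul_sum, ← mul_assoc, ← hR, Finset.sum_mul]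
    exact Finset.sum_comm
  have ha0 : S ^ a ≠ 0 := (ENNReal.rpow_pos (pos_iff_ne_zero.2 h0) ht).ne'
  have hat : S ^ a ≠ ∞ := ENNReal.rpow_ne_top_of_ne_zero h0 ht
  refine ⟨R, fun Q => ?_⟩
  rw [fidelity_ofReal ha ha', fidelity_ofReal ha ha', hsum, ENNReal.mul_rpow_eq_ite,
    if_neg (by simp [ha0, hat]), ← ENNReal.rpow_mul, mul_one_div]

theorem fidelity_ofReal_self {a : ℝ} (ha : 0 < a) (ha' : a ≠ 1) (R : PMF Y) :
    fidelity (ENNReal.ofReal a) R R = 1 := by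
  have (y : Y) : R y ^ a * R y ^ (1 - a) = R y := by
    rw [← mul_div_rpow_one_sub (R.apply_ne_top y) (R.apply_ne_top y) ha]
    by_cases hy : R y = 0
    · simp [hy]
    · rw [ENNReal.div_self hy (R.apply_ne_top y), ENNReal.one_rpow, mul_one]
  rw [fidelity_ofReal ha ha', hellingerSum, Finset.sum_congr rfl fun y _ => this y, sum_pmf_coe,
    ENNReal.one_rpow]

theorem fidelity_prodDist_le_sibsonSum {a : ℝ} (ha : 0 < a) (ha' : a ≠ 1) (P : PMF X)
    (W : Channel X Y) (Q : PMF Y) :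
    fidelity (ENNReal.ofReal a) (joint P W) (prodDist P Q) ≤ sibsonSum a P W ^ (a / (1 - a)) := by
  obtain ⟨R, hR⟩ := exists_fidelity_prodDist_eq ha ha' P W
  rw [hR]
  exact mul_le_of_le_one_right' (fidelity_le_one _ (sum_pmf_coe R) (sum_pmf_coe Q))

theorem exists_fidelity_prodDist_eq_sibsonSum {a : ℝ} (ha : 0 < a) (ha' : a ≠ 1) (P : PMF X)
    (W : Channel X Y) :
    ∃ Q : PMF Y, fidelity (ENNReal.ofReal a) (joint P W) (prodDist P Q) =
      sibsonSum a P W ^ (a / (1 - a)) := by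
  obtain ⟨R, hR⟩ := exists_fidelity_prodDist_eq ha ha' P W
  exact ⟨R, by rw [hR, fidelity_ofReal_self ha ha', mul_one]⟩

theorem sibsonSum_iid_power {a : ℝ} (ha : 0 < a) (P : PMF X) (W : Channel X Y) (n : ℕ) :
    sibsonSum a (iid P n) (W.power n) = sibsonSum a P W ^ n := by
  rw [sibsonSum, sibsonSum, Fintype.sum_pow]
  refine Finset.sum_congr rfl fun y _ => ?_
  rw [ENNReal.prod_rpow_of_nonneg (by positivity), Fintype.prod_sum]
  simp only [iid_apply, Channel.power_apply, Finset.prod_mul_distrib,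
    ← ENNReal.prod_rpow_of_nonneg ha.le]

theorem fidelity_zero_prodDist (P : PMF X) (W : Channel X Y) (Q : PMF Y) :
    fidelity 0 (joint P W) (prodDist P Q) = ∑ y, Q y * fidelity 0 (fun x => W x y) P := by
  rw [prodDist_eq_joint, fidelity_zero_joint]
  simp only [fidelity_zero, Finset.mul_sum]
  rw [Finset.sum_comm]
  refine Finset.sum_congr rfl fun y _ => Finset.sum_congr rfl fun x _ => ?_
  by_cases hW : W x y = 0 <;> simp [hW, mul_comm]

theorem fidelity_zero_prodDist_iid_power_le {P : PMF X} {W : Channel X Y} {s : ℝ≥0∞}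
    (hs : ∀ Q : PMF Y, fidelity 0 (joint P W) (prodDist P Q) ≤ s) (n : ℕ) (Q : PMF (Fin n → Y)) :
    fidelity 0 (joint (iid P n) (W.power n)) (prodDist (iid P n) Q) ≤ s ^ n := by
  classical
  have hletter (y : Y) : fidelity 0 (fun x => W x y) P ≤ s := by
    simpa [fidelity_zero_prodDist, PMF.pure_apply] using hs (PMF.pure y)
  have hword (y : Fin n → Y) : fidelity 0 (fun x => W.power n x y) (iid P n) ≤ s ^ n :=
    calc fidelity 0 (fun x => W.power n x y) (iid P n)
        = ∏ i, fidelity 0 (fun x => W x (y i)) P :=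
          fidelity_zero_pi (fun i x => W x (y i)) fun _ => P
      _ ≤ ∏ _i : Fin n, s := Finset.prod_le_prod' fun i _ => hletter (y i)
      _ = s ^ n := by simp
  calc fidelity 0 (joint (iid P n) (W.power n)) (prodDist (iid P n) Q)
      ≤ ∑ y, Q y * s ^ n := by
        rw [fidelity_zero_prodDist]
        exact Finset.sum_le_sum fun y _ => mul_le_mul_right (hword y) _
    _ = s ^ n := by rw [← Finset.sum_mul, sum_pmf_coe, one_mul]

theorem fidelity_top_prodDist_le_inv (P : PMF X) (W : Channel X Y) (Q : PMF Y) {ξ : Y → X}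
    (hξ : ∀ y, P (ξ y) ≠ 0) :
    fidelity ∞ (joint P W) (prodDist P Q) ≤ (∑ y, W (ξ y) y)⁻¹ := by
  rw [prodDist_eq_joint, ENNReal.le_inv_iff_mul_le, Finset.mul_sum, ← sum_pmf_coe Q]
  refine Finset.sum_le_sum fun y _ => ?_
  calc fidelity ∞ (joint P W) (joint P fun _ => Q) * W (ξ y) y
      ≤ fidelity ∞ (W (ξ y)) Q * W (ξ y) y := by
        gcongr
        exact fidelity_top_joint_le P W (fun _ => Q) (hξ y)
    _ ≤ Q y := fidelity_top_mul_le ((W (ξ y)).apply_ne_top y)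

theorem exists_inv_le_fidelity_top_prodDist (P : PMF X) (W : Channel X Y) :
    ∃ ξ : Y → X, (∀ y, P (ξ y) ≠ 0) ∧
      ∃ Q : PMF Y, (∑ y, W (ξ y) y)⁻¹ ≤ fidelity ∞ (joint P W) (prodDist P Q) := by
  have hmax (y : Y) : ∃ x ∈ P.support, ∀ x' ∈ P.support, W x' y ≤ W x y :=
    P.support.toFinite.exists_maximalFor (W · y) P.support P.support_nonempty |>.imp
      fun x hx => ⟨hx.1, fun x' hx' => (le_total (W x y) (W x' y)).elim (hx.2 hx') id⟩
  choose ξ hξ hmax using hmax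
  have ht : ∑ y, W (ξ y) y ≠ ∞ := ENNReal.sum_ne_top.2 fun y _ => (W (ξ y)).apply_ne_top y
  have h0 : ∑ y, W (ξ y) y ≠ 0 := by
    obtain ⟨x, hx⟩ := P.support_nonempty
    obtain ⟨y, hy⟩ := (W x).support_nonempty
    exact fun h => hy (le_zero_iff.1 ((hmax y x hx).trans_eq
      (Finset.sum_eq_zero_iff.1 h y (Finset.mem_univ y))))
  refine ⟨ξ, hξ, PMF.normalize (fun y => W (ξ y) y) (by rwa [tsum_fintype])
    (by rwa [tsum_fintype]), ?_⟩
  rw [fidelity_top]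
  refine le_iInf₂ fun p hp => ?_
  have hp1 : P p.1 ≠ 0 := left_ne_zero_of_mul hp
  have hp2 : W p.1 p.2 ≠ 0 := right_ne_zero_of_mul hp
  rw [prodDist, joint, ENNReal.mul_div_mul_left _ _ hp1 (P.apply_ne_top _),
    ENNReal.le_div_iff_mul_le (.inl hp2) (.inl ((W p.1).apply_ne_top _)), PMF.normalize_apply,
    tsum_fintype, mul_comm]
  exact mul_le_mul_left (hmax _ _ hp1) _

theorem fidelity_prodDist_iid_power_le {α : ℝ≥0∞} (hα : α ≠ 1) {P : PMF X} {W : Channel X Y}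
    {s : ℝ≥0∞} (hs : ∀ Q : PMF Y, fidelity α (joint P W) (prodDist P Q) ≤ s) (n : ℕ)
    (Q : PMF (Fin n → Y)) :
    fidelity α (joint (iid P n) (W.power n)) (prodDist (iid P n) Q) ≤ s ^ n := by
  rcases order_cases α with rfl | rfl | rfl | ⟨a, ha, ha', rfl⟩
  · exact fidelity_zero_prodDist_iid_power_le hs n Q
  · exact absurd rfl hα
  · obtain ⟨ξ, hξ, Q', hQ'⟩ := exists_inv_le_fidelity_top_prodDist P W
    calc fidelity ∞ (joint (iid P n) (W.power n)) (prodDist (iid P n) Q)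
        ≤ (∑ y, W.power n (fun i => ξ (y i)) y)⁻¹ :=
          fidelity_top_prodDist_le_inv _ _ _ fun y => by
            simpa only [iid_apply, Finset.prod_ne_zero_iff] using fun i _ => hξ (y i)
      _ = (∑ y, W (ξ y) y)⁻¹ ^ n := by
          simp only [Channel.power_apply, ← ENNReal.inv_pow, Fintype.sum_pow]
      _ ≤ s ^ n := pow_le_pow_left' (hQ'.trans (hs Q')) n
  · obtain ⟨Q', hQ'⟩ := exists_fidelity_prodDist_eq_sibsonSum ha ha' P W
    calc fidelity (ENNReal.ofReal a) (joint (iid P n) (W.power n)) (prodDist (iid P n) Q)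
        ≤ sibsonSum a (iid P n) (W.power n) ^ (a / (1 - a)) :=
          fidelity_prodDist_le_sibsonSum ha ha' _ _ Q
      _ = (sibsonSum a P W ^ (a / (1 - a))) ^ n := by
          rw [sibsonSum_iid_power ha, ← ENNReal.rpow_natCast_mul, mul_comm,
            ENNReal.rpow_mul_natCast]
      _ ≤ s ^ n := pow_le_pow_left' (hQ' ▸ hs Q') n

theorem le_renyiMutualInfo_iff {α : ℝ≥0∞} {P : PMF X} {W : Channel X Y} {t : ℝ} :
    t ≤ renyiMutualInfo α P W ↔
      ∀ Q : PMF Y, fidelity α (joint P W) (prodDist P Q) ≤ 2 ^ (-t) := by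
  simp only [renyiMutualInfo, le_iInf_iff, le_renyiDiv_iff]

theorem le_renyiMutualInfo_iid_power {α : ℝ≥0∞} (hα : α ≠ 1) {P : PMF X} {W : Channel X Y} {t : ℝ}
    (ht : t ≤ renyiMutualInfo α P W) (n : ℕ) :
    ((n * t : ℝ) : EReal) ≤ renyiMutualInfo α (iid P n) (W.power n) := by
  rw [le_renyiMutualInfo_iff] at ht ⊢
  intro Q
  rw [neg_mul_eq_mul_neg, mul_comm, ENNReal.rpow_mul_natCast]
  exact fidelity_prodDist_iid_power_le hα ht n Q

end MutualInformation

section SimulationRate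

theorem exists_le_of_mem_simulations {X Y : Type*} {c : ℝ} {M : Channel X Y}
    (hM : M ∈ simulations X Y c) : ∃ Q : PMF Y, ∀ x y, M x y ≤ 2 ^ c * Q y := by
  obtain ⟨N, hN, hc, K, _, PK, E, D, h⟩ := hM
  have : NeZero N := ⟨Nat.one_le_iff_ne_zero.1 hN⟩
  have hNc : (N : ℝ≥0∞) ≤ 2 ^ c := by
    rw [← ENNReal.ofReal_natCast, two_rpow_eq_ofReal]
    exact ENNReal.ofReal_le_ofReal
      ((Real.logb_le_iff_le_rpow one_lt_two (by exact_mod_cast hN)).1 hc)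
  have hNN : (N : ℝ≥0∞) * (N : ℝ≥0∞)⁻¹ = 1 :=
    ENNReal.mul_inv_cancel (NeZero.ne _) (ENNReal.natCast_ne_top N)
  refine ⟨PK.bind fun k => (PMF.uniformOfFintype (Fin N)).bind fun j => D (j, k), fun x y => ?_⟩
  calc M x y ≤ ∑ k, ∑ j, PK k * D (j, k) y := by
        rw [h]
        gcongr with k _ j _
        exact mul_le_of_le_one_right' (PMF.coe_le_one _ _)
    _ = N * ∑ k, PK k * ∑ j, (N : ℝ≥0∞)⁻¹ * D (j, k) y := by
        simp only [Finset.mul_sum]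
        refine Finset.sum_congr rfl fun k _ => Finset.sum_congr rfl fun j _ => ?_
        rw [mul_left_comm, ← mul_assoc (N : ℝ≥0∞), hNN, one_mul]
    _ ≤ 2 ^ c * ∑ k, PK k * ∑ j, (N : ℝ≥0∞)⁻¹ * D (j, k) y := mul_le_mul_left hNc _
    _ = _ := by simp [PMF.bind_apply, tsum_fintype]

variable {X Y : Type*} [Fintype X] [Fintype Y] {α : ℝ≥0∞}

theorem fidelity_joint_le_of_mem_simulations {c t : ℝ} {P : PMF X} {W M : Channel X Y}
    (hM : M ∈ simulations X Y c) (ht : t ≤ renyiMutualInfo α P W) :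
    fidelity α (joint P W) (joint P M) ≤ 2 ^ (c - t) := by
  obtain ⟨Q, hQ⟩ := exists_le_of_mem_simulations hM
  calc fidelity α (joint P W) (joint P M)
      ≤ fidelity α (joint P W) (fun p => 2 ^ c * prodDist P Q p) := by
        refine fidelity_mono_right _ _ fun p => ?_
        rw [joint, prodDist, mul_left_comm]
        exact mul_le_mul_right (hQ _ _) _
    _ = 2 ^ c * fidelity α (joint P W) (prodDist P Q) :=
        fidelity_const_mul_right _ (sum_joint P W) _ (two_rpow_pos c).ne' (two_rpow_ne_top c)
    _ ≤ 2 ^ c * 2 ^ (-t) := mul_le_mul_right (le_renyiMutualInfo_iff.1 ht Q) _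
    _ = 2 ^ (c - t) := by rw [← two_rpow_add, sub_eq_add_neg]

theorem exists_mem_simulations_of_simPerformance_lt {W : Channel X Y} {c δ : ℝ}
    (h : simPerformance α W c < δ) :
    ∃ M ∈ simulations X Y c, ∀ P, 2 ^ (-δ) ≤ fidelity α (joint P W) (joint P M) := by
  obtain ⟨M, hM, hlt⟩ : ∃ M, ∃ _ : M ∈ simulations X Y c, channelDiv α W M < δ := by
    simpa only [simPerformance, iInf_lt_iff] using h
  exact ⟨M, hM, fun P => renyiDiv_le_iff.1 ((le_iSup _ P).trans hlt.le)⟩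

theorem le_renyiSimulationRate_of_forall {W : Channel X Y} {t k : ℝ}
    (h : ∀ (n : ℕ) (c : ℝ), simPerformance α (W.power n) c < (1 : ℝ) → k + n * t ≤ c) :
    t ≤ renyiSimulationRate α W := by
  refine le_sInf ?_
  rintro _ ⟨c, -, hlim, rfl⟩
  have hperf : ∀ᶠ n in atTop, simPerformance α (W.power n) (c n) < (1 : ℝ) :=
    eventually_lt_of_limsup_lt (by rw [hlim]; exact_mod_cast zero_lt_one)
  have hcost : ∀ᶠ n : ℕ in atTop, ((k / n + t : ℝ) : EReal) ≤ ((c n / n : ℝ) : EReal) := by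
    filter_upwards [hperf, eventually_gt_atTop 0] with n hn hn0
    have hn' : (0 : ℝ) < n := by exact_mod_cast hn0
    rw [EReal.coe_le_coe_iff, div_add' _ _ _ hn'.ne', mul_comm]
    gcongr
    exact h n (c n) hn
  have hlim' : Tendsto (fun n : ℕ => ((k / n + t : ℝ) : EReal)) atTop (𝓝 t) := by
    refine EReal.tendsto_coe.2 ?_
    simpa using (tendsto_const_div_atTop_nhds_zero_nat k).add_const t
  exact hlim'.limsup_eq.symm.trans_le (limsup_le_limsup hcost)

theorem simPerformance_nonneg [Nonempty X] (α : ℝ≥0∞) (W : Channel X Y) (c : ℝ) :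
    0 ≤ simPerformance α W c :=
  le_iInf₂ fun M _ => (renyiDiv_nonneg α (sum_joint _ W) (sum_joint _ M)).trans
    (le_iSup (fun P => renyiDiv α (joint P W) (joint P M)) (PMF.pure (Classical.arbitrary X)))

theorem renyiSimulationRate_le_of_limsup_nonpos [Nonempty X] {W : Channel X Y} {c : ℕ → ℝ}
    (hc : ∀ n, 0 ≤ c n)
    (h : limsup (fun n => simPerformance α (W.power n) (c n)) atTop ≤ 0) :
    renyiSimulationRate α W ≤ limsup (fun n => ((c n / n : ℝ) : EReal)) atTop :=
  sInf_le ⟨c, hc, h.antisymm (le_limsup_of_frequently_le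
    (Frequently.of_forall fun n => simPerformance_nonneg α _ _)), rfl⟩

theorem renyiSimulationRate_le_of_fidelity_le [Nonempty X] {β : ℝ≥0∞} (W : Channel X Y)
    (h : ∀ (n : ℕ) (P : PMF (Fin n → X)) (M : Channel (Fin n → X) (Fin n → Y)),
      fidelity β (joint P (W.power n)) (joint P M) ≤
        fidelity α (joint P (W.power n)) (joint P M)) :
    renyiSimulationRate α W ≤ renyiSimulationRate β W := by
  refine le_sInf ?_
  rintro _ ⟨c, hc, hlim, rfl⟩
  refine renyiSimulationRate_le_of_limsup_nonpos hc ((limsup_le_limsup ?_).trans_eq hlim)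
  exact .of_forall fun n => iInf₂_mono fun M _ => iSup_mono fun P =>
    EReal.neg_le_neg_iff.2 (log₂_strictMono.monotone (h n P M))

theorem renyiSimulationRate_le_rate_one [Nonempty X] (hα : 0 < α) (hα' : α ≤ 1)
    (W : Channel X Y) : renyiSimulationRate α W ≤ renyiSimulationRate 1 W :=
  renyiSimulationRate_le_of_fidelity_le W fun _ P M =>
    fidelity_one_le_of_le_one (sum_joint P _) (joint_ne_top P M) hα hα'

theorem renyiSimulationRate_one_le [Nonempty X] {a : ℝ} (ha : 1 < a) (W : Channel X Y) :
    renyiSimulationRate 1 W ≤ renyiSimulationRate (ENNReal.ofReal a) W :=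
  renyiSimulationRate_le_of_fidelity_le W fun _ P M =>
    fidelity_ofReal_le_fidelity_one (sum_joint P _) (joint_ne_top P M) ha

theorem two_rpow_le_two_rpow_iff {s t : ℝ} : (2 : ℝ≥0∞) ^ s ≤ 2 ^ t ↔ s ≤ t :=
  (show StrictMono fun s : ℝ => (2 : ℝ≥0∞) ^ s from fun _ _ h =>
    ENNReal.rpow_lt_rpow_of_exponent_lt ENNReal.one_lt_two ENNReal.ofNat_ne_top h).le_iff_le

theorem renyiCapacity_le_renyiSimulationRate (hα : α ≠ 1) (W : Channel X Y) :
    renyiCapacity α W ≤ renyiSimulationRate α W := by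
  refine EReal.ge_of_forall_gt_iff_ge.1 fun t ht => ?_
  obtain ⟨P, hP⟩ := lt_iSup_iff.1 ht
  refine le_renyiSimulationRate_of_forall (k := -1) fun n c hc => ?_
  obtain ⟨M, hM, hfid⟩ := exists_mem_simulations_of_simPerformance_lt hc
  have := two_rpow_le_two_rpow_iff.1 ((hfid (iid P n)).trans
    (fidelity_joint_le_of_mem_simulations hM (le_renyiMutualInfo_iid_power hα hP.le n)))
  linarith

end SimulationRate

section OrderOne

theorem hasDerivAt_const_rpow_one {w : ℝ} (hw : 0 ≤ w) :
    HasDerivAt (fun b : ℝ => w ^ b) (w * Real.log w) 1 := by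
  rcases hw.eq_or_lt with rfl | hw
  · rw [zero_mul]
    refine (hasDerivAt_const (1 : ℝ) (0 : ℝ)).congr_of_eventuallyEq ?_
    filter_upwards [lt_mem_nhds one_pos] with b hb
    exact Real.zero_rpow (ne_of_gt hb)
  · simpa using (Real.hasStrictDerivAt_const_rpow hw 1).hasDerivAt

theorem tendsto_ofReal_rpow_one_div_one_sub {f : ℝ → ℝ} {J : ℝ} (hf : HasDerivAt f J 1)
    (h1 : f 1 = 1) :
    Tendsto (fun b => ENNReal.ofReal (f b) ^ (1 / (1 - b))) (𝓝[≠] 1)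
      (𝓝 (ENNReal.ofReal (Real.exp (-J)))) := by
  have hlog : HasDerivAt (fun b => Real.log (f b)) J 1 := by
    simpa [h1] using hf.log (by rw [h1]; exact one_ne_zero)
  have hpos : ∀ᶠ b in 𝓝[≠] 1, 0 < f b :=
    (hf.continuousAt.eventually_const_lt (by rw [h1]; exact one_pos)).filter_mono nhdsWithin_le_nhds
  have hexp := (Real.continuous_exp.tendsto _).comp (hasDerivAt_iff_tendsto_slope.1 hlog).neg
  refine (ENNReal.tendsto_ofReal hexp).congr' ?_
  filter_upwards [hpos] with b hb
  rw [ENNReal.ofReal_rpow_of_pos hb, Real.rpow_def_of_pos hb, Function.comp_apply,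
    slope_def_field, h1, Real.log_one, sub_zero, mul_one_div, ← div_neg, neg_sub]

section RelEntropy

variable {A : Type*} [Fintype A] {P Q : A → ℝ≥0∞}

/-- The relative entropy of `P` with respect to `Q`, in nats and as a real number. It is meaningful
only if `P x = 0` whenever `Q x = 0`. -/
def relEntropy (P Q : A → ℝ≥0∞) : ℝ :=
  ∑ x, (P x).toReal * Real.log (P x / Q x).toReal

theorem fidelity_one_eq_exp (hP : ∀ x, P x ≠ ∞) (hQ : ∀ x, Q x ≠ ∞)
    (hPQ : ∀ x, Q x = 0 → P x = 0) :
    fidelity 1 P Q = ENNReal.ofReal (Real.exp (-relEntropy P Q)) := by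
  rw [fidelity_one, relEntropy, ← Finset.sum_neg_distrib, Real.exp_sum,
    ENNReal.ofReal_prod_of_nonneg fun _ _ => (Real.exp_pos _).le]
  refine Finset.prod_congr rfl fun x _ => ?_
  by_cases hx : P x = 0
  · simp [hx]
  have hpos : 0 < (Q x / P x).toReal :=
    ENNReal.toReal_pos (ENNReal.div_ne_zero.2 ⟨mt (hPQ x) hx, hP x⟩) (ENNReal.div_ne_top (hQ x) hx)
  rw [← ENNReal.inv_div (.inl (hP x)) (.inl hx), ENNReal.toReal_inv, Real.log_inv, mul_neg, neg_neg,
    mul_comm, ← Real.rpow_def_of_pos hpos, ← ENNReal.ofReal_rpow_of_pos hpos,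
    ENNReal.ofReal_toReal (ENNReal.div_ne_top (hQ x) hx)]

theorem hellingerSum_eq_ofReal (hP : ∀ x, P x ≠ ∞) (hQ : ∀ x, Q x ≠ ∞)
    (hPQ : ∀ x, Q x = 0 → P x = 0) {b : ℝ} (hb : 0 < b) :
    hellingerSum b P Q = ENNReal.ofReal (∑ x, (Q x).toReal * (P x / Q x).toReal ^ b) := by
  rw [ENNReal.ofReal_sum_of_nonneg fun _ _ => by positivity]
  refine Finset.sum_congr rfl fun x _ => ?_
  by_cases hx : Q x = 0
  · simp [hx, hPQ x hx, hb]
  · rw [ENNReal.ofReal_mul ENNReal.toReal_nonneg, ENNReal.toReal_rpow, ENNReal.ofReal_toReal (hQ x),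
      ENNReal.ofReal_toReal (ENNReal.rpow_ne_top_of_nonneg hb.le (ENNReal.div_ne_top (hP x) hx)),
      ENNReal.div_rpow_of_nonneg _ _ hb.le, ENNReal.rpow_sub _ _ hx (hQ x), ENNReal.rpow_one,
      div_eq_mul_inv, div_eq_mul_inv]
    ring

theorem hasDerivAt_sum_mul_div_rpow_one (hQ : ∀ x, Q x ≠ ∞) (hPQ : ∀ x, Q x = 0 → P x = 0) :
    HasDerivAt (fun b : ℝ => ∑ x, (Q x).toReal * (P x / Q x).toReal ^ b) (relEntropy P Q) 1 := by
  refine HasDerivAt.fun_sum fun x _ => ?_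
  refine ((hasDerivAt_const_rpow_one ENNReal.toReal_nonneg).const_mul _).congr_deriv ?_
  rw [← mul_assoc, ← ENNReal.toReal_mul,
    ENNReal.mul_div_cancel' (fun h => hPQ x h) (fun h => absurd h (hQ x))]

theorem tendsto_fidelity_ofReal_one (hP : ∑ x, P x = 1) (hQ : ∀ x, Q x ≠ ∞)
    (hPQ : ∀ x, Q x = 0 → P x = 0) :
    Tendsto (fun b => fidelity (ENNReal.ofReal b) P Q) (𝓝[≠] 1) (𝓝 (fidelity 1 P Q)) := by
  have hPtop := ne_top_of_sum_eq_one hP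
  have hsum : ∑ x, (Q x).toReal * (P x / Q x).toReal ^ (1 : ℝ) = 1 := by
    refine (Finset.sum_congr rfl fun x _ => ?_).trans (sum_toReal_eq_one hP)
    rw [Real.rpow_one, ← ENNReal.toReal_mul,
      ENNReal.mul_div_cancel' (fun h => hPQ x h) (fun h => absurd h (hQ x))]
  rw [fidelity_one_eq_exp hPtop hQ hPQ]
  have hderiv := hasDerivAt_sum_mul_div_rpow_one hQ hPQ
  refine (tendsto_ofReal_rpow_one_div_one_sub hderiv hsum).congr' ?_
  filter_upwards [self_mem_nhdsWithin, (lt_mem_nhds one_pos).filter_mono nhdsWithin_le_nhds]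
    with b hb hb0
  rw [fidelity_ofReal hb0 hb, hellingerSum_eq_ofReal hPtop hQ hPQ hb0]

end RelEntropy

section Sibson

variable {X Y : Type*}

theorem bind_apply_ne_zero {P : PMF X} {W : Channel X Y} {x : X} {y : Y} (hx : P x ≠ 0)
    (hy : W x y ≠ 0) : P.bind W y ≠ 0 :=
  (PMF.mem_support_bind_iff _ _ _).2 ⟨x, hx, hy⟩

variable [Fintype X]

theorem toReal_bind_apply (P : PMF X) (W : Channel X Y) (y : Y) :
    (P.bind W y).toReal = ∑ x, (P x).toReal * (W x y).toReal := by
  rw [PMF.bind_apply, tsum_fintype, ENNReal.toReal_sum fun x _ =>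
    ENNReal.mul_ne_top (P.apply_ne_top x) ((W x).apply_ne_top y)]
  simp only [ENNReal.toReal_mul]

theorem hasDerivAt_sum_mul_rpow_rpow_inv {p w : X → ℝ} (hp : ∀ x, 0 ≤ p x) (hw : ∀ x, 0 ≤ w x) :
    HasDerivAt (fun b : ℝ => (∑ x, p x * w x ^ b) ^ (1 / b))
      (∑ x, p x * w x * (Real.log (w x) - Real.log (∑ x, p x * w x))) 1 := by
  have hpw (x : X) : 0 ≤ p x * w x := mul_nonneg (hp x) (hw x)
  rcases (Finset.sum_nonneg fun x _ => hpw x).eq_or_lt with h0 | hpos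
  · have hzero (x : X) : p x * w x = 0 :=
      (Finset.sum_eq_zero_iff_of_nonneg fun x _ => hpw x).1 h0.symm x (Finset.mem_univ x)
    simp only [hzero, zero_mul, Finset.sum_const_zero]
    refine (hasDerivAt_const (1 : ℝ) (0 : ℝ)).congr_of_eventuallyEq ?_
    filter_upwards [lt_mem_nhds one_pos] with b hb
    have hterm (x : X) : p x * w x ^ b = 0 := by
      rcases mul_eq_zero.1 (hzero x) with h | h <;> simp [h, Real.zero_rpow (ne_of_gt hb)]
    simp only [hterm, Finset.sum_const_zero, Real.zero_rpow (one_div_pos.2 hb).ne']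
  · have hsum : HasDerivAt (fun b : ℝ => ∑ x, p x * w x ^ b)
        (∑ x, p x * (w x * Real.log (w x))) 1 :=
      HasDerivAt.fun_sum fun x _ => (hasDerivAt_const_rpow_one (hw x)).const_mul (p x)
    have hinv : HasDerivAt (fun b : ℝ => 1 / b) (-1) 1 := by
      simpa using hasDerivAt_inv (one_ne_zero (α := ℝ))
    refine (hsum.rpow hinv (by simpa using hpos)).congr_deriv ?_
    simp only [Real.rpow_one, div_one, sub_self, Real.rpow_zero, mul_one, mul_sub,
      Finset.sum_sub_distrib, ← mul_assoc, ← Finset.sum_mul]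
    ring

variable [Fintype Y]

theorem sibsonSum_eq_ofReal {b : ℝ} (hb : 0 < b) (P : PMF X) (W : Channel X Y) :
    sibsonSum b P W =
      ENNReal.ofReal (∑ y, (∑ x, (P x).toReal * (W x y).toReal ^ b) ^ (1 / b)) := by
  rw [← ENNReal.ofReal_toReal (sibsonSum_ne_top hb P W), sibsonSum,
    ENNReal.toReal_sum fun y _ => ENNReal.rpow_ne_top_of_nonneg (by positivity)
      (sum_mul_rpow_ne_top hb P W y)]
  congr! with y
  rw [← ENNReal.toReal_rpow, ENNReal.toReal_sum fun x _ => ENNReal.mul_ne_top (P.apply_ne_top x)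
    (ENNReal.rpow_ne_top_of_nonneg hb.le ((W x).apply_ne_top y))]
  simp only [ENNReal.toReal_mul, ENNReal.toReal_rpow]

theorem relEntropy_joint (P : PMF X) (W M : Channel X Y) :
    relEntropy (joint P W) (joint P M) = ∑ x, (P x).toReal * relEntropy (W x) (M x) := by
  simp only [relEntropy, Fintype.sum_prod_type, joint, ENNReal.toReal_mul, Finset.mul_sum,
    mul_assoc]
  refine Finset.sum_congr rfl fun x _ => Finset.sum_congr rfl fun y _ => ?_
  by_cases hP : P x = 0
  · simp [hP]
  · rw [ENNReal.mul_div_mul_left _ _ hP (P.apply_ne_top x)]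

theorem relEntropy_joint_prodDist_bind (P : PMF X) (W : Channel X Y) :
    relEntropy (joint P W) (prodDist P (P.bind W)) = ∑ y, ∑ x, (P x).toReal * (W x y).toReal *
      (Real.log (W x y).toReal - Real.log (∑ x, (P x).toReal * (W x y).toReal)) := by
  rw [prodDist_eq_joint, relEntropy_joint]
  simp only [relEntropy, Finset.mul_sum, ← toReal_bind_apply, mul_assoc]
  rw [Finset.sum_comm]
  refine Finset.sum_congr rfl fun y _ => Finset.sum_congr rfl fun x _ => ?_
  by_cases hP : P x = 0
  · simp [hP]
  by_cases hW : W x y = 0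
  · simp [hW]
  rw [ENNReal.toReal_div, Real.log_div (ENNReal.toReal_ne_zero.2 ⟨hW, (W x).apply_ne_top y⟩)
    (ENNReal.toReal_ne_zero.2 ⟨bind_apply_ne_zero hP hW, PMF.apply_ne_top _ y⟩)]

theorem tendsto_sibsonSum_rpow_one (P : PMF X) (W : Channel X Y) :
    Tendsto (fun b => sibsonSum b P W ^ (b / (1 - b))) (𝓝[≠] 1)
      (𝓝 (fidelity 1 (joint P W) (prodDist P (P.bind W)))) := by
  set S : ℝ → ℝ := fun b => ∑ y, (∑ x, (P x).toReal * (W x y).toReal ^ b) ^ (1 / b) with hS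
  have hS1 : S 1 = 1 := by
    simp only [hS, Real.rpow_one, div_one, ← toReal_bind_apply]
    exact sum_toReal_eq_one (sum_pmf_coe _)
  have hderiv : HasDerivAt S (relEntropy (joint P W) (prodDist P (P.bind W))) 1 := by
    rw [relEntropy_joint_prodDist_bind]
    exact HasDerivAt.fun_sum fun y _ => hasDerivAt_sum_mul_rpow_rpow_inv
      (fun _ => ENNReal.toReal_nonneg) (fun _ => ENNReal.toReal_nonneg)
  have hpow : HasDerivAt (fun b => S b ^ b) (relEntropy (joint P W) (prodDist P (P.bind W))) 1 :=
    (hderiv.rpow (hasDerivAt_id 1) (by rw [hS1]; exact one_pos)).congr_deriv (by simp [hS1])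
  have hac (p : X × Y) (hp : prodDist P (P.bind W) p = 0) : joint P W p = 0 := by
    contrapose! hp
    exact mul_ne_zero (left_ne_zero_of_mul hp)
      (bind_apply_ne_zero (left_ne_zero_of_mul hp) (right_ne_zero_of_mul hp))
  rw [fidelity_one_eq_exp (Q := prodDist P (P.bind W)) (joint_ne_top P W)
    (joint_ne_top P fun _ => P.bind W) hac]
  refine (tendsto_ofReal_rpow_one_div_one_sub hpow (by simp [hS1])).congr' ?_
  filter_upwards [(lt_mem_nhds one_pos).filter_mono nhdsWithin_le_nhds] with b hb
  rw [sibsonSum_eq_ofReal hb, ← ENNReal.ofReal_rpow_of_nonneg _ hb.le, ← ENNReal.rpow_mul,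
    mul_one_div]
  exact Finset.sum_nonneg fun y _ => Real.rpow_nonneg
    (Finset.sum_nonneg fun x _ => by positivity) _

theorem eventually_le_renyiMutualInfo {P : PMF X} {W : Channel X Y} {t : ℝ}
    (ht : t < mutualInfo P W) :
    ∀ᶠ b in 𝓝[≠] (1 : ℝ), t ≤ renyiMutualInfo (ENNReal.ofReal b) P W := by
  filter_upwards [self_mem_nhdsWithin, (lt_mem_nhds one_pos).filter_mono nhdsWithin_le_nhds,
    (tendsto_sibsonSum_rpow_one P W).eventually_lt_const (lt_renyiDiv_iff.1 ht)] with b hb hb0 hlt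
  exact le_renyiMutualInfo_iff.2 fun Q => (fidelity_prodDist_le_sibsonSum hb0 hb P W Q).trans hlt.le

end Sibson

theorem eventually_renyiDiv_lt {A : Type*} [Fintype A] {P Q : A → ℝ≥0∞} (hP : ∑ x, P x = 1)
    (hQ : ∀ x, Q x ≠ ∞) {t : ℝ} (ht : renyiDiv 1 P Q < t) :
    ∀ᶠ b in 𝓝[≠] (1 : ℝ), renyiDiv (ENNReal.ofReal b) P Q < t := by
  have hpos := renyiDiv_lt_iff.1 ht
  have hac (x : A) (hx : Q x = 0) : P x = 0 := by
    by_contra hPx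
    refine (pos_of_gt hpos).ne'
      ((fidelity_one _ _).trans (Finset.prod_eq_zero (Finset.mem_univ x) ?_))
    rw [hx, ENNReal.zero_div,
      ENNReal.zero_rpow_of_pos (ENNReal.toReal_pos hPx (ne_top_of_sum_eq_one hP x))]
  filter_upwards [(tendsto_fidelity_ofReal_one hP hQ hac).eventually_const_lt hpos] with b hb
  exact renyiDiv_lt_iff.2 hb

theorem shannonCapacity_le_renyiSimulationRate_of_lt_one {X Y : Type*} [Fintype X] [Fintype Y]
    {a : ℝ} (ha : 0 < a) (ha' : a < 1) (W : Channel X Y) :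
    shannonCapacity W ≤ renyiSimulationRate (ENNReal.ofReal a) W := by
  refine EReal.ge_of_forall_gt_iff_ge.1 fun t ht => ?_
  obtain ⟨P, hP⟩ := lt_iSup_iff.1 ht
  obtain ⟨b, hb, hab, hb'⟩ : ∃ b : ℝ, t ≤ renyiMutualInfo (ENNReal.ofReal b) P W ∧ a < b ∧ b < 1 :=
    (((eventually_le_renyiMutualInfo hP).filter_mono (nhdsLT_le_nhdsNE 1)).and
      (Ioo_mem_nhdsLT ha')).exists
  have hκ : 0 < a * (1 - b) / (b * (1 - a)) :=
    div_pos (mul_pos ha (sub_pos.2 hb')) (mul_pos (ha.trans hab) (sub_pos.2 ha'))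
  set κ := a * (1 - b) / (b * (1 - a))
  refine le_renyiSimulationRate_of_forall (k := -1 / κ) fun n c hc => ?_
  obtain ⟨M, hM, hfid⟩ := exists_mem_simulations_of_simPerformance_lt hc
  have hb1 : ENNReal.ofReal b ≠ 1 := by simpa using hb'.ne
  have hpow : (2 : ℝ≥0∞) ^ (-1 : ℝ) ≤ 2 ^ ((c - n * t) * κ) := by
    rw [ENNReal.rpow_mul]
    refine (hfid (iid P n)).trans
      ((fidelity_ofReal_le_rpow_of_lt (sum_joint _ M) ha hab hb').trans ?_)
    exact ENNReal.rpow_le_rpow (fidelity_joint_le_of_mem_simulations hM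
      (le_renyiMutualInfo_iid_power hb1 hb n)) hκ.le
  have := (div_le_iff₀ hκ).2 (two_rpow_le_two_rpow_iff.1 hpow)
  linarith

theorem shannonCapacity_le_renyiSimulationRate {X Y : Type*} [Fintype X] [Nonempty X] [Fintype Y]
    {α : ℝ≥0∞} (hα : 0 < α) (hα' : α ≤ 1) (W : Channel X Y) :
    shannonCapacity W ≤ renyiSimulationRate α W := by
  rcases hα'.eq_or_lt with rfl | hlt
  · exact (shannonCapacity_le_renyiSimulationRate_of_lt_one one_half_pos one_half_lt_one W).trans
      (renyiSimulationRate_le_rate_one (by simp) (by norm_num) W)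
  · have hα_top : α ≠ ∞ := (hlt.trans ENNReal.one_lt_top).ne
    rw [← ENNReal.ofReal_toReal hα_top]
    exact shannonCapacity_le_renyiSimulationRate_of_lt_one (ENNReal.toReal_pos hα.ne' hα_top)
      (by simpa using (ENNReal.toReal_lt_toReal hα_top ENNReal.one_ne_top).2 hlt) W

end OrderOne

section RejectionSampling

section Mixture

variable {A B : Type*}

/-- The mixture `a P + (1 - a) R` of two probability distributions. -/
def mix (a : ℝ≥0∞) (ha : a ≤ 1) (P R : PMF A) : PMF A :=
  ⟨fun x => a * P x + (1 - a) * R x, by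
    rw [Summable.hasSum_iff ENNReal.summable, ENNReal.tsum_add, ENNReal.tsum_mul_left,
      ENNReal.tsum_mul_left, P.tsum_coe, R.tsum_coe, mul_one, mul_one, add_tsub_cancel_of_le ha]⟩

theorem mix_apply {a : ℝ≥0∞} (ha : a ≤ 1) (P R : PMF A) (x : A) :
    mix a ha P R x = a * P x + (1 - a) * R x := rfl

theorem mix_bind {a : ℝ≥0∞} (ha : a ≤ 1) (P R : PMF A) (f : A → PMF B) :
    (mix a ha P R).bind f = mix a ha (P.bind f) (R.bind f) := by
  ext y
  simp only [PMF.bind_apply, mix_apply, add_mul, ENNReal.tsum_add, mul_assoc, ENNReal.tsum_mul_left]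

theorem bind_mix_const_left {a : ℝ≥0∞} (ha : a ≤ 1) (P : PMF A) (R : PMF B) (f : A → PMF B) :
    (P.bind fun x => mix a ha R (f x)) = mix a ha R (P.bind f) := by
  ext y
  simp only [PMF.bind_apply, mix_apply, mul_add, ENNReal.tsum_add, mul_left_comm (P _),
    ENNReal.tsum_mul_left, ENNReal.tsum_mul_right, P.tsum_coe, one_mul]

theorem bind_mix_pure_apply [Fintype A] (Q R : PMF A) {a : A → ℝ≥0∞} (ha : ∀ x, a x ≤ 1) (y : A) :
    Q.bind (fun x => mix (a x) (ha x) (PMF.pure x) R) y =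
      Q y * a y + (1 - ∑ x, Q x * a x) * R y := by
  have hreject : ∑ x, Q x * (1 - a x) = 1 - ∑ x, Q x * a x := by
    refine ENNReal.eq_sub_of_add_eq (ENNReal.sum_ne_top.2 fun x _ =>
      ENNReal.mul_ne_top (Q.apply_ne_top x) (ne_top_of_le_ne_top ENNReal.one_ne_top (ha x))) ?_
    simp only [← Finset.sum_add_distrib, ← mul_add, tsub_add_cancel_of_le (ha _), mul_one,
      sum_pmf_coe]
  classical
  simp only [PMF.bind_apply, tsum_fintype, mix_apply, mul_add, Finset.sum_add_distrib, ← hreject,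
    Finset.sum_mul, PMF.pure_apply, mul_ite, mul_one, mul_zero, Finset.sum_ite_eq, Finset.mem_univ,
    if_true, mul_assoc]

end Mixture

variable {X Y : Type*}

/-- The channel `M` is realized by `N` messages and shared randomness of arbitrary finite size. -/
def IsSimulatedBy (N : ℕ) (M : Channel X Y) : Prop :=
  ∃ (K : Type) (_ : Fintype K) (PK : PMF K) (E : Channel (X × K) (Fin N))
    (D : Channel (Fin N × K) Y), ∀ x, M x = PK.bind fun k => (E (x, k)).bind fun j => D (j, k)

theorem IsSimulatedBy.mem_simulations {N : ℕ} {M : Channel X Y} (h : IsSimulatedBy N M)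
    (hN : 1 ≤ N) {c : ℝ} (hc : Real.logb 2 N ≤ c) : M ∈ simulations X Y c := by
  obtain ⟨K, _, PK, E, D, hM⟩ := h
  exact ⟨N, hN, hc, K, ‹_›, PK, E, D, fun x y => by
    simp only [hM, PMF.bind_apply, tsum_fintype, Finset.mul_sum, mul_assoc]⟩

theorem isSimulatedBy_of_finite {K : Type*} [Finite K] {N : ℕ} (PK : PMF K)
    (E : Channel (X × K) (Fin N)) (D : Channel (Fin N × K) Y) :
    IsSimulatedBy N fun x => PK.bind fun k => (E (x, k)).bind fun j => D (j, k) := by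
  let e := Finite.equivFin K
  refine ⟨Fin (Nat.card K), inferInstance, PK.map e, fun p => E (p.1, e.symm p.2),
    fun p => D (p.1, e.symm p.2), fun x => ?_⟩
  simp only [PMF.bind_map, Function.comp_def, Equiv.symm_apply_apply]

theorem isSimulatedBy_const (Q : PMF Y) : IsSimulatedBy 1 (fun _ : X => Q) := by
  simpa only [PMF.pure_bind] using
    isSimulatedBy_of_finite (PMF.pure ()) (fun _ : X × Unit => PMF.pure 0) fun _ => Q

-- The shared randomness is enlarged by a sample `z` of `Q`; the additional message accepts `z`.
theorem IsSimulatedBy.succ [Finite Y] {N : ℕ} {M : Channel X Y} (h : IsSimulatedBy N M)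
    (Q : PMF Y) {a : X → Y → ℝ≥0∞} (ha : ∀ x y, a x y ≤ 1) :
    IsSimulatedBy (N + 1) fun x => Q.bind fun z => mix (a x z) (ha x z) (PMF.pure z) (M x) := by
  obtain ⟨K, _, PK, E, D, hM⟩ := h
  convert isSimulatedBy_of_finite (Q.bind fun z => PK.map fun k => (z, k))
    (fun p : X × Y × K => mix (a p.1 p.2.1) (ha p.1 p.2.1) (PMF.pure 0)
      ((E (p.1, p.2.2)).map Fin.succ))
    (fun p => Fin.cases (PMF.pure p.2.1) (fun j => D (j, p.2.2)) p.1) using 2 with x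
  simp only [PMF.bind_bind, PMF.bind_map, Function.comp_def, mix_bind, PMF.pure_bind,
    Fin.cases_zero, Fin.cases_succ, hM]
  exact congrArg Q.bind (funext fun z => (bind_mix_const_left (ha x z) PK _ _).symm)

theorem exists_isSimulatedBy_ge [Finite Y] {L : Channel X Y} {Q : PMF Y} {A : ℝ≥0∞} (hA : 1 ≤ A)
    (hL : ∀ x y, L x y ≤ A * Q y) (m : ℕ) :
    ∃ M : Channel X Y, IsSimulatedBy (m + 1) M ∧ ∀ x y, (1 - (1 - A⁻¹) ^ m) * L x y ≤ M x y := by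
  have := Fintype.ofFinite Y
  induction m with
  | zero => exact ⟨fun _ => Q, isSimulatedBy_const Q, fun x y => by simp⟩
  | succ m ih =>
    obtain ⟨M, hM, hle⟩ := ih
    have : A ≠ 0 := (zero_lt_one.trans_le hA).ne'
    have hA1 : A⁻¹ ≤ 1 := ENNReal.inv_le_one.2 hA
    have haccept (x : X) (y : Y) : L x y / (A * Q y) ≤ 1 :=
      ENNReal.div_le_of_le_mul (by simpa using hL x y)
    have hsample (x : X) (y : Y) : Q y * (L x y / (A * Q y)) = A⁻¹ * L x y := by
      by_cases hQ : Q y = 0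
      · simp [hQ, show L x y = 0 by simpa [hQ] using hL x y]
      · rw [mul_comm A, ← mul_div_assoc, ENNReal.mul_div_mul_left _ _ hQ (Q.apply_ne_top y),
          ENNReal.div_eq_inv_mul]
    refine ⟨_, hM.succ Q haccept, fun x y => ?_⟩
    rw [bind_mix_pure_apply]
    simp only [hsample, ← Finset.mul_sum, sum_pmf_coe, mul_one]
    set r := 1 - A⁻¹ with hr
    have hpow : 1 - r ^ (m + 1) = A⁻¹ + r * (1 - r ^ m) := by
      have hr1 : r ≤ 1 := tsub_le_self
      refine (ENNReal.eq_sub_of_add_eq (by finiteness) ?_).symm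
      rw [add_assoc, pow_succ', ← mul_add, tsub_add_cancel_of_le (pow_le_one₀ zero_le hr1), mul_one,
        hr, add_tsub_cancel_of_le hA1]
    calc (1 - r ^ (m + 1)) * L x y = A⁻¹ * L x y + r * ((1 - r ^ m) * L x y) := by rw [hpow]; ring
      _ ≤ A⁻¹ * L x y + r * M x y := by gcongr; exact hle x y

end RejectionSampling

section SamplingRate

variable {X Y : Type*} [Fintype X] [Fintype Y] {α : ℝ≥0∞}

theorem simPerformance_le {W L : Channel X Y} {Q : PMF Y} {A θ : ℝ≥0∞} (hA : 1 ≤ A)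
    (hL : ∀ x y, L x y ≤ A * Q y) (hθ : ∀ P : PMF X, θ ≤ fidelity α (joint P W) (joint P L))
    {m : ℕ} {c ε : ℝ} (hc : Real.logb 2 (m + 1 : ℕ) ≤ c) (hε : 2 ^ (-ε) ≤ (1 - (1 - A⁻¹) ^ m) * θ) :
    simPerformance α W c ≤ ε := by
  obtain ⟨M, hM, hle⟩ := exists_isSimulatedBy_ge hA hL m
  refine iInf₂_le_of_le M (hM.mem_simulations (Nat.le_add_left 1 m) hc)
    (iSup_le fun P => renyiDiv_le_iff.2 ?_)
  have hη : 1 - (1 - A⁻¹) ^ m ≠ 0 := left_ne_zero_of_mul ((two_rpow_pos _).trans_le hε).ne'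
  calc 2 ^ (-ε) ≤ (1 - (1 - A⁻¹) ^ m) * θ := hε
    _ ≤ (1 - (1 - A⁻¹) ^ m) * fidelity α (joint P W) (joint P L) := mul_le_mul_right (hθ P) _
    _ = fidelity α (joint P W) (fun p => (1 - (1 - A⁻¹) ^ m) * joint P L p) :=
        (fidelity_const_mul_right α (sum_joint P W) _ hη (by finiteness)).symm
    _ ≤ fidelity α (joint P W) (joint P M) := fidelity_mono_right _ _ fun p => by
        rw [joint, joint, mul_left_comm]
        exact mul_le_mul_right (hle _ _) _

theorem one_sub_inv_pow_le {x : ℝ} (hx : 1 ≤ x) (m : ℕ) :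
    (1 - (ENNReal.ofReal x)⁻¹) ^ m ≤ ENNReal.ofReal (Real.exp (-(m / x))) := by
  have hx0 : 0 < x := one_pos.trans_le hx
  rw [← ENNReal.ofReal_inv_of_pos hx0, ← ENNReal.ofReal_one,
    ← ENNReal.ofReal_sub _ (inv_nonneg.2 hx0.le),
    ← ENNReal.ofReal_pow (sub_nonneg.2 (inv_le_one_of_one_le₀ hx)), div_eq_mul_inv, ← mul_neg,
    Real.exp_nat_mul]
  refine ENNReal.ofReal_le_ofReal (pow_le_pow_left₀ (sub_nonneg.2 (inv_le_one_of_one_le₀ hx)) ?_ m)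
  exact Real.one_sub_le_exp_neg _

theorem tendsto_floor_two_rpow_sub_one_div {r R : ℝ} (hr : 0 ≤ r) (hrR : r < R) :
    Tendsto (fun n : ℕ => ((⌊(2 : ℝ) ^ (n * R)⌋₊ - 1 : ℕ) : ℝ) / 2 ^ (1 + n * r)) atTop atTop := by
  have hgrow : Tendsto (fun n : ℕ => ((2 : ℝ) ^ (R - r)) ^ n / 2 - 1) atTop atTop :=
    tendsto_atTop_add_const_right _ _ ((tendsto_pow_atTop_atTop_of_one_lt
      (Real.one_lt_rpow one_lt_two (sub_pos.2 hrR))).atTop_div_const two_pos)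
  refine tendsto_atTop_mono (fun n => ?_) hgrow
  have hfloor : (2 : ℝ) ^ (n * R) - 2 ≤ (⌊(2 : ℝ) ^ (n * R)⌋₊ - 1 : ℕ) := by
    have := Nat.lt_floor_add_one ((2 : ℝ) ^ (n * R))
    have : (⌊(2 : ℝ) ^ (n * R)⌋₊ : ℝ) ≤ (⌊(2 : ℝ) ^ (n * R)⌋₊ - 1 : ℕ) + 1 := by
      exact_mod_cast le_tsub_add
    linarith
  have hone : (2 : ℝ) / 2 ^ (1 + n * r) ≤ 1 := by
    rw [div_le_one (by positivity)]
    exact Real.self_le_rpow_of_one_le one_le_two (by simpa using by positivity)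
  calc ((2 : ℝ) ^ (R - r)) ^ n / 2 - 1 = 2 ^ (n * R) / 2 ^ (1 + n * r) - 1 := by
        rw [← Real.rpow_mul_natCast two_pos.le, ← Real.rpow_sub two_pos,
          ← Real.rpow_sub_one two_ne_zero]
        ring_nf
    _ ≤ (2 ^ (n * R) - 2) / 2 ^ (1 + n * r) := by rw [sub_div]; gcongr
    _ ≤ _ := by gcongr

theorem tendsto_one_sub_inv_pow_floor {r R : ℝ} (hr : 0 ≤ r) (hrR : r < R) :
    Tendsto (fun n : ℕ => (1 - ((2 : ℝ≥0∞) ^ (1 + n * r))⁻¹) ^ (⌊(2 : ℝ) ^ (n * R)⌋₊ - 1))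
      atTop (𝓝 0) := by
  have hexp := ENNReal.tendsto_ofReal (Real.tendsto_exp_neg_atTop_nhds_zero.comp
    (tendsto_floor_two_rpow_sub_one_div hr hrR))
  rw [ENNReal.ofReal_zero] at hexp
  refine tendsto_of_tendsto_of_tendsto_of_le_of_le tendsto_const_nhds hexp (fun _ => zero_le)
    fun n => ?_
  have := one_sub_inv_pow_le (Real.one_le_rpow one_le_two (show 0 ≤ 1 + n * r by positivity))
    (⌊(2 : ℝ) ^ (n * R)⌋₊ - 1)
  rwa [← two_rpow_eq_ofReal] at this

theorem limsup_simPerformance_nonpos {W : Channel X Y} {r R : ℝ} (hr : 0 ≤ r) (hrR : r < R)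
    (Q : ∀ n, PMF (Fin n → Y)) (L : ∀ n, Channel (Fin n → X) (Fin n → Y))
    (hL : ∀ n x y, L n x y ≤ 2 ^ (1 + n * r) * Q n y) {θ : ℕ → ℝ≥0∞} (hθ : Tendsto θ atTop (𝓝 1))
    (hF : ∀ n (P : PMF (Fin n → X)), θ n ≤ fidelity α (joint P (W.power n)) (joint P (L n))) :
    limsup (fun n => simPerformance α (W.power n) (n * R)) atTop ≤ 0 := by
  refine EReal.le_of_forall_lt_iff_le.1 fun ε hε => ?_
  have hprod : Tendsto (fun n : ℕ => (1 - (1 - ((2 : ℝ≥0∞) ^ (1 + n * r))⁻¹) ^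
      (⌊(2 : ℝ) ^ (n * R)⌋₊ - 1)) * θ n) atTop (𝓝 1) := by
    have hη := ENNReal.Tendsto.sub (tendsto_const_nhds (x := (1 : ℝ≥0∞)))
      (tendsto_one_sub_inv_pow_floor hr hrR) (.inl ENNReal.one_ne_top)
    simpa using ENNReal.Tendsto.mul hη (.inl (by simp)) hθ (.inl one_ne_zero)
  have hlt : (2 : ℝ≥0∞) ^ (-ε) < 1 :=
    ENNReal.rpow_lt_one_of_one_lt_of_neg ENNReal.one_lt_two (neg_lt_zero.2 (by exact_mod_cast hε))
  refine limsup_le_of_le (h := ?_)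
  filter_upwards [hprod.eventually_const_lt hlt] with n hn
  have hR : 0 ≤ R := hr.trans hrR.le
  have hfloor : 1 ≤ ⌊(2 : ℝ) ^ (n * R)⌋₊ :=
    (Nat.one_le_floor_iff _).2 (Real.one_le_rpow one_le_two (by positivity))
  refine simPerformance_le ?_ (hL n) (hF n) ?_ hn.le
  · exact ENNReal.one_le_rpow one_le_two (by positivity)
  · rw [Nat.sub_add_cancel hfloor, Real.logb_le_iff_le_rpow one_lt_two (by exact_mod_cast hfloor)]
    exact Nat.floor_le (by positivity)

theorem renyiSimulationRate_le_of_forall [Nonempty X] {W : Channel X Y} {r : ℝ} (hr : 0 ≤ r)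
    (Q : ∀ n, PMF (Fin n → Y)) (L : ∀ n, Channel (Fin n → X) (Fin n → Y))
    (hL : ∀ n x y, L n x y ≤ 2 ^ (1 + n * r) * Q n y) {θ : ℕ → ℝ≥0∞} (hθ : Tendsto θ atTop (𝓝 1))
    (hF : ∀ n (P : PMF (Fin n → X)), θ n ≤ fidelity α (joint P (W.power n)) (joint P (L n))) :
    renyiSimulationRate α W ≤ r := by
  refine EReal.le_of_forall_lt_iff_le.1 fun R hR => ?_
  have hrR : r < R := EReal.coe_lt_coe_iff.1 hR
  have hcost : (fun n : ℕ => ((n * R / n : ℝ) : EReal)) =ᶠ[atTop] fun _ => (R : EReal) := by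
    filter_upwards [eventually_gt_atTop 0] with n hn
    rw [mul_div_cancel_left₀ _ (by exact_mod_cast hn.ne')]
  refine (renyiSimulationRate_le_of_limsup_nonpos (fun n => ?_)
    (limsup_simPerformance_nonpos hr hrR Q L hL hθ hF)).trans_eq ?_
  · exact mul_nonneg n.cast_nonneg (hr.trans hrR.le)
  · rw [limsup_congr hcost, limsup_const]

end SamplingRate

section Minimax

theorem convexOn_finset_sum {ι E : Type*} [Fintype ι] [AddCommGroup E] [Module ℝ E] {C : Set E}
    (hC : Convex ℝ C) {f : ι → E → ℝ} (hf : ∀ i, ConvexOn ℝ C (f i)) :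
    ConvexOn ℝ C fun q => ∑ i, f i q := by
  refine ⟨hC, fun q hq r hr a b ha hb hab => ?_⟩
  simp only [Finset.smul_sum, ← Finset.sum_add_distrib]
  exact Finset.sum_le_sum fun i _ => (hf i).2 hq hr ha hb hab

theorem exists_forall_lt_of_forall_exists_sum_lt {ι E : Type*} [Fintype ι] [Nonempty ι]
    [AddCommGroup E] [Module ℝ E] [TopologicalSpace E] [IsTopologicalAddGroup E]
    [ContinuousSMul ℝ E] {C : Set E} {φ : ι → E → ℝ} (hφ : ∀ i, ConvexOn ℝ C (φ i))
    (hφ' : ∀ i, ContinuousOn (φ i) C) {t : ℝ}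
    (h : ∀ p ∈ stdSimplex ℝ ι, ∃ q ∈ C, ∑ i, p i * φ i q < t) :
    ∃ q ∈ C, ∀ i, φ i q < t := by
  classical
  set f : (ι → ℝ) → E → ℝ := fun p q => -∑ i, p i * φ i q with hf
  have hconv (q : E) : ConvexOn ℝ (stdSimplex ℝ ι) (f · q) := by
    refine ⟨convex_stdSimplex ℝ ι, fun p _ r _ a b _ _ _ => le_of_eq ?_⟩
    simp only [hf, Pi.add_apply, Pi.smul_apply, smul_eq_mul, add_mul, mul_assoc,
      Finset.sum_add_distrib, ← Finset.mul_sum]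
    ring
  have hconc (p : ι → ℝ) (hp : p ∈ stdSimplex ℝ ι) : ConcaveOn ℝ C (f p) :=
    (convexOn_finset_sum (hφ (Classical.arbitrary ι)).1 fun i => (hφ i).smul (hp.1 i)).neg
  have hcont (q : E) : Continuous (f · q) := by fun_prop
  choose! q hqC hq using h
  obtain ⟨s, hs, hcover⟩ := (isCompact_stdSimplex ℝ ι).elim_nhds_subcover
    (fun p => {r | -t < f r (q p)}) fun p hp =>
      (isOpen_lt continuous_const (hcont _)).mem_nhds (neg_lt_neg (hq p hp))
  obtain ⟨q₀, hq₀, hlt⟩ := Sion.exists_lt_iInf_of_lt_iInf_of_finite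
    (X := stdSimplex ℝ ι) (Y := C) (f := f) (s := q '' s) (t := -t)
    ⟨_, single_mem_stdSimplex ℝ (Classical.arbitrary ι)⟩ (isCompact_stdSimplex ℝ ι)
    (fun q _ => (hcont q).lowerSemicontinuous.lowerSemicontinuousOn _)
    (fun q _ => (hconv q).quasiconvexOn) (hφ (Classical.arbitrary ι)).1
    (fun p _ => ContinuousOn.upperSemicontinuousOn (by fun_prop))
    (fun p hp => (hconc p hp).quasiconcaveOn) (convex_stdSimplex ℝ ι)
    (s.finite_toSet.image q) (Set.image_subset_iff.2 fun p hp => hqC p (hs p hp))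
    (fun p hp => by simpa using hcover hp)
  refine ⟨q₀, hq₀, fun i => ?_⟩
  simpa [hf, Pi.single_apply] using hlt _ (single_mem_stdSimplex ℝ i)

theorem convexOn_rpow_of_nonpos {s : ℝ} (hs : s ≤ 0) :
    ConvexOn ℝ (Set.Ioi 0) fun u : ℝ => u ^ s := by
  have hlog : ConvexOn ℝ (Set.Ioi 0) fun u : ℝ => s * Real.log u := by
    simpa [Pi.smul_def] using (strictConcaveOn_log_Ioi.concaveOn.neg.smul (neg_nonneg.2 hs))
  have hexp : ConvexOn ℝ (Set.Ioi 0) fun u : ℝ => Real.exp (s * Real.log u) :=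
    ⟨convex_Ioi 0, fun u hu v hv a b ha hb hab =>
      (Real.exp_le_exp.2 (hlog.2 hu hv ha hb hab)).trans
        (convexOn_exp.2 (Set.mem_univ _) (Set.mem_univ _) ha hb hab)⟩
  exact hexp.congr fun u hu => by rw [Real.rpow_def_of_pos hu, mul_comm]

end Minimax

section InformationRadius

section RealVectors

variable {A : Type*} [Fintype A]

/-- The probability distribution given by a point of the standard simplex, through which the
minimax theorem over real vectors applies to probability distributions. -/
def pmfOfStdSimplex (p : A → ℝ) (hp : p ∈ stdSimplex ℝ A) : PMF A :=
  PMF.ofFintype (fun x => ENNReal.ofReal (p x)) (by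
    rw [← ENNReal.ofReal_sum_of_nonneg fun x _ => hp.1 x, hp.2, ENNReal.ofReal_one])

theorem toReal_pmfOfStdSimplex {p : A → ℝ} (hp : p ∈ stdSimplex ℝ A) (x : A) :
    (pmfOfStdSimplex p hp x).toReal = p x :=
  ENNReal.toReal_ofReal (hp.1 x)

theorem toReal_mem_stdSimplex (P : PMF A) : (fun x => (P x).toReal) ∈ stdSimplex ℝ A :=
  ⟨fun _ => ENNReal.toReal_nonneg, sum_toReal_eq_one (sum_pmf_coe P)⟩

end RealVectors

theorem nonempty_output {X Y : Type*} [Nonempty X] (W : Channel X Y) : Nonempty Y :=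
  ⟨(W (Classical.arbitrary X)).support_nonempty.choose⟩

variable {X Y : Type*} [Fintype X] [Fintype Y] {α : ℝ≥0∞} {W : Channel X Y} {t : ℝ}

theorem exists_renyiDiv_prodDist_lt (h : renyiCapacity α W < t) (P : PMF X) :
    ∃ Q : PMF Y, renyiDiv α (joint P W) (prodDist P Q) < t :=
  iInf_lt_iff.1 ((le_iSup (fun P => renyiMutualInfo α P W) P).trans_lt h)

theorem exists_ne_zero_renyiDiv_prodDist_lt [Nonempty Y] {P : PMF X} {Q : PMF Y}
    (h : renyiDiv α (joint P W) (prodDist P Q) < t) :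
    ∃ Q' : PMF Y, (∀ y, Q' y ≠ 0) ∧ renyiDiv α (joint P W) (prodDist P Q') < t := by
  rw [renyiDiv_lt_iff] at h
  have hfin : fidelity α (joint P W) (prodDist P Q) ≠ ∞ :=
    ne_top_of_le_ne_top ENNReal.one_ne_top
      (fidelity_le_one α (sum_joint P W) (sum_joint P fun _ => Q))
  have hlim : Tendsto (fun c => c * fidelity α (joint P W) (prodDist P Q)) (𝓝[<] 1)
      (𝓝 (fidelity α (joint P W) (prodDist P Q))) :=
    ((ENNReal.continuous_mul_const hfin).tendsto' 1 _ (one_mul _)).mono_left nhdsWithin_le_nhds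
  have : (𝓝[<] (1 : ℝ≥0∞)).NeBot := nhdsLT_neBot_of_exists_lt ⟨0, one_pos⟩
  obtain ⟨c, hc, hc1 : c < 1⟩ := ((hlim.eventually_const_lt h).and self_mem_nhdsWithin).exists
  have hc0 : c ≠ 0 := by
    rintro rfl
    simp at hc
  refine ⟨mix c hc1.le Q (PMF.uniformOfFintype Y), fun y => ?_, renyiDiv_lt_iff.2 ?_⟩
  · simp [mix_apply, (tsub_pos_of_lt hc1).ne']
  · refine hc.trans_le ?_
    rw [← fidelity_const_mul_right α (sum_joint P W) _ hc0 hc1.ne_top]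
    refine fidelity_mono_right _ _ fun p => ?_
    rw [prodDist, prodDist, mix_apply, mul_left_comm]
    exact mul_le_mul_right le_self_add _

theorem fidelity_joint_pure (α : ℝ≥0∞) (x : X) (W M : Channel X Y) :
    fidelity α (joint (PMF.pure x) W) (joint (PMF.pure x) M) = fidelity α (W x) (M x) := by
  classical
  rcases order_cases α with rfl | rfl | rfl | ⟨a, ha, ha', rfl⟩
  · simp [fidelity_zero_joint, PMF.pure_apply]
  · rw [fidelity_one, fidelity_one, Fintype.prod_prod_type, Finset.prod_eq_single x]
    · simp [joint]
    · intro x' _ hx'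
      simp [joint, PMF.pure_apply, hx']
    · simp
  · refine le_antisymm (fidelity_top_joint_le _ _ _ (by simp)) ?_
    simp only [fidelity_top]
    refine le_iInf₂ fun ⟨x', y⟩ hp => ?_
    obtain rfl : x' = x := by simpa [PMF.mem_support_pure_iff] using left_ne_zero_of_mul hp
    have hy : W x' y ≠ 0 := right_ne_zero_of_mul hp
    exact (iInf₂_le y hy).trans_eq (by simp [joint])
  · simp [fidelity_ofReal ha ha', hellingerSum_joint _ _ _ ha, PMF.pure_apply]

theorem exists_forall_renyiDiv_lt_of_convexOn [Nonempty X] {φ : X → Y → ℝ → ℝ} {u : ℝ}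
    (hφ : ∀ x y, ConvexOn ℝ (Set.Ioi 0) (φ x y))
    (hiff : ∀ (P : PMF X) (Q : PMF Y), (∀ y, Q y ≠ 0) →
      (renyiDiv α (joint P W) (prodDist P Q) < t ↔
        ∑ x, (P x).toReal * ∑ y, φ x y (Q y).toReal < u))
    (h : renyiCapacity α W < t) : ∃ Q : PMF Y, ∀ x, renyiDiv α (W x) Q < t := by
  classical
  have := nonempty_output W
  set C : Set (Y → ℝ) := stdSimplex ℝ Y ∩ {q | ∀ y, 0 < q y}
  have hC : Convex ℝ C := (convex_stdSimplex ℝ Y).inter fun q hq r hr a b ha hb hab y =>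
    convex_Ioi (0 : ℝ) (hq y) (hr y) ha hb hab
  have hmem {Q : PMF Y} (hQ : ∀ y, Q y ≠ 0) : (fun y => (Q y).toReal) ∈ C :=
    ⟨toReal_mem_stdSimplex Q, fun y => ENNReal.toReal_pos (hQ y) (Q.apply_ne_top y)⟩
  obtain ⟨q, hq, hlt⟩ := exists_forall_lt_of_forall_exists_sum_lt (C := C)
    (φ := fun x q => ∑ y, φ x y (q y)) (t := u)
    (fun x => convexOn_finset_sum hC fun y =>
      ((hφ x y).comp_linearMap (LinearMap.proj (R := ℝ) (φ := fun _ : Y => ℝ) y)).subset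
        (fun q hq => hq.2 y) hC)
    (fun x => continuousOn_finsetSum _ fun y _ =>
      ((hφ x y).continuousOn isOpen_Ioi).comp (continuous_apply y).continuousOn fun q hq => hq.2 y)
    fun p hp => by
      obtain ⟨Q, hQ⟩ := exists_renyiDiv_prodDist_lt h (pmfOfStdSimplex p hp)
      obtain ⟨Q', hQ'0, hQ'⟩ := exists_ne_zero_renyiDiv_prodDist_lt hQ
      refine ⟨_, hmem hQ'0, ?_⟩
      simpa only [toReal_pmfOfStdSimplex] using (hiff _ Q' hQ'0).1 hQ'
  set Q := pmfOfStdSimplex q hq.1 with hQ_def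
  have hQ0 (y : Y) : Q y ≠ 0 := (ENNReal.ofReal_pos.2 (hq.2 y)).ne'
  refine ⟨Q, fun x => ?_⟩
  rw [renyiDiv, ← fidelity_joint_pure α x W fun _ => Q]
  refine (hiff (PMF.pure x) Q hQ0).2 ?_
  simpa [PMF.pure_apply, apply_ite, hQ_def, toReal_pmfOfStdSimplex] using hlt x

theorem sum_mul_ofReal_sum (P : PMF X) {f : X → Y → ℝ} (hf : ∀ x y, 0 ≤ f x y) :
    ∑ x, P x * ∑ y, ENNReal.ofReal (f x y) =
      ENNReal.ofReal (∑ x, (P x).toReal * ∑ y, f x y) := by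
  rw [ENNReal.ofReal_sum_of_nonneg fun x _ =>
    mul_nonneg ENNReal.toReal_nonneg (Finset.sum_nonneg fun y _ => hf x y)]
  refine Finset.sum_congr rfl fun x _ => ?_
  rw [ENNReal.ofReal_mul ENNReal.toReal_nonneg, ENNReal.ofReal_toReal (P.apply_ne_top x),
    ENNReal.ofReal_sum_of_nonneg fun y _ => hf x y]

theorem ofReal_toReal_rpow_mul_rpow {p q : ℝ≥0∞} (hp : p ≠ ∞) (hq : q ≠ 0) (hq' : q ≠ ∞) {a b : ℝ}
    (ha : 0 ≤ a) : ENNReal.ofReal (p.toReal ^ a * q.toReal ^ b) = p ^ a * q ^ b := by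
  rw [ENNReal.toReal_rpow, ENNReal.toReal_rpow, ← ENNReal.toReal_mul,
    ENNReal.ofReal_toReal (ENNReal.mul_ne_top (ENNReal.rpow_ne_top_of_nonneg ha hp)
      (ENNReal.rpow_ne_top_of_ne_zero hq hq'))]

theorem lt_rpow_one_div_one_sub_iff {a t : ℝ} (ha : 1 < a) {s : ℝ≥0∞} :
    2 ^ (-t) < s ^ (1 / (1 - a)) ↔ s < 2 ^ ((a - 1) * t) := by
  have ha' : 0 < a - 1 := sub_pos.2 ha
  have hexp : (2 : ℝ≥0∞) ^ (-t) = (2 ^ ((a - 1) * t)) ^ (1 / (1 - a)) := by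
    rw [← ENNReal.rpow_mul]
    congr 1
    rw [← neg_sub a 1]
    field_simp
  rw [hexp, one_div, ← neg_sub a 1, inv_neg, ENNReal.rpow_neg, ENNReal.rpow_neg,
    ENNReal.inv_lt_inv, ENNReal.rpow_lt_rpow_iff (inv_pos.2 ha')]

theorem exists_forall_renyiDiv_lt_of_one_lt [Nonempty X] {a : ℝ} (ha : 1 < a)
    (h : renyiCapacity (ENNReal.ofReal a) W < t) :
    ∃ Q : PMF Y, ∀ x, renyiDiv (ENNReal.ofReal a) (W x) Q < t := by
  have ha0 : 0 < a := zero_lt_one.trans ha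
  refine exists_forall_renyiDiv_lt_of_convexOn (u := 2 ^ ((a - 1) * t))
    (φ := fun x y q => (W x y).toReal ^ a * q ^ (1 - a))
    (fun x y => (convexOn_rpow_of_nonpos (by linarith)).smul (by positivity))
    (fun P Q hQ => ?_) h
  have hsum : hellingerSum a (joint P W) (prodDist P Q) = ENNReal.ofReal
      (∑ x, (P x).toReal * ∑ y, (W x y).toReal ^ a * (Q y).toReal ^ (1 - a)) := by
    rw [prodDist_eq_joint, hellingerSum_joint _ _ _ ha0,
      ← sum_mul_ofReal_sum P fun _ _ => by positivity]
    simp only [hellingerSum, ofReal_toReal_rpow_mul_rpow (PMF.apply_ne_top _ _) (hQ _)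
      (PMF.apply_ne_top _ _) ha0.le]
  rw [renyiDiv_lt_iff, fidelity_ofReal ha0 ha.ne', lt_rpow_one_div_one_sub_iff ha, hsum,
    two_rpow_eq_ofReal, ENNReal.ofReal_lt_ofReal_iff (by positivity)]

theorem exists_forall_renyiDiv_lt_zero [Nonempty X] (h : renyiCapacity 0 W < t) :
    ∃ Q : PMF Y, ∀ x, renyiDiv 0 (W x) Q < t := by
  classical
  refine exists_forall_renyiDiv_lt_of_convexOn (u := -2 ^ (-t))
    (φ := fun x y q => -(Function.support (W x)).indicator (fun _ => q) y)
    (fun x y => ?_) (fun P Q _ => ?_) h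
  · by_cases hy : y ∈ Function.support (W x)
    · simp only [Set.indicator_of_mem hy]
      exact (concaveOn_id (𝕜 := ℝ) (convex_Ioi (0 : ℝ))).neg
    · simpa [hy] using convexOn_const (0 : ℝ) (convex_Ioi (0 : ℝ))
  have hsum : fidelity 0 (joint P W) (prodDist P Q) = ENNReal.ofReal
      (∑ x, (P x).toReal * ∑ y, (Function.support (W x)).indicator (fun _ => (Q y).toReal) y) := by
    rw [prodDist_eq_joint, fidelity_zero_joint,
      ← sum_mul_ofReal_sum P fun _ _ => Set.indicator_nonneg (fun _ _ => by positivity) _]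
    simp [fidelity_zero, Set.indicator_apply, apply_ite, PMF.apply_ne_top]
  rw [renyiDiv_lt_iff, hsum, two_rpow_eq_ofReal,
    ENNReal.ofReal_lt_ofReal_iff_of_nonneg (by positivity)]
  simp only [Finset.sum_neg_distrib, mul_neg, neg_lt_neg_iff]

theorem renyiCapacity_one_le_shannonCapacity (W : Channel X Y) :
    renyiCapacity 1 W ≤ shannonCapacity W :=
  iSup_mono fun P => iInf_le (fun Q => renyiDiv 1 (joint P W) (prodDist P Q)) (P.bind W)

theorem exists_forall_renyiDiv_lt_one [Nonempty X] (h : renyiCapacity 1 W < t) :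
    ∃ Q : PMF Y, ∀ x, renyiDiv 1 (W x) Q < t := by
  refine exists_forall_renyiDiv_lt_of_convexOn (u := t * Real.log 2)
    (φ := fun x y q => (W x y).toReal * (Real.log (W x y).toReal - Real.log q))
    (fun x y => ((convexOn_const (𝕜 := ℝ) _ (convex_Ioi 0)).sub
      strictConcaveOn_log_Ioi.concaveOn).smul (c := (W x y).toReal) ENNReal.toReal_nonneg)
    (fun P Q hQ => ?_) h
  have hsum : relEntropy (joint P W) (prodDist P Q) = ∑ x, (P x).toReal *
      ∑ y, (W x y).toReal * (Real.log (W x y).toReal - Real.log (Q y).toReal) := by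
    rw [prodDist_eq_joint, relEntropy_joint]
    simp only [relEntropy]
    refine Finset.sum_congr rfl fun x _ => congrArg _ (Finset.sum_congr rfl fun y _ => ?_)
    by_cases hW : W x y = 0
    · simp [hW]
    rw [ENNReal.toReal_div, Real.log_div (ENNReal.toReal_ne_zero.2 ⟨hW, (W x).apply_ne_top y⟩)
      (ENNReal.toReal_ne_zero.2 ⟨hQ y, Q.apply_ne_top y⟩)]
  have hac (p : X × Y) (hp : prodDist P Q p = 0) : joint P W p = 0 :=
    mul_eq_zero_of_left ((mul_eq_zero.1 hp).resolve_right (hQ p.2)) _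
  rw [renyiDiv_lt_iff, fidelity_one_eq_exp (Q := prodDist P Q) (joint_ne_top P W)
    (joint_ne_top P fun _ => Q) hac, hsum, two_rpow_eq_ofReal,
    ENNReal.ofReal_lt_ofReal_iff (Real.exp_pos _), Real.rpow_def_of_pos two_pos,
    Real.exp_lt_exp, mul_neg, neg_lt_neg_iff, mul_comm]

theorem exists_forall_renyiDiv_lt_top [Nonempty X] (h : renyiCapacity ∞ W < t) :
    ∃ Q : PMF Y, ∀ x, renyiDiv ∞ (W x) Q < t := by
  obtain ⟨Q, hQ⟩ := exists_renyiDiv_prodDist_lt h (PMF.uniformOfFintype X)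
  refine ⟨Q, fun x => renyiDiv_lt_iff.2 ((renyiDiv_lt_iff.1 hQ).trans_le ?_)⟩
  exact fidelity_top_joint_le _ W (fun _ => Q) (by simp)

theorem exists_forall_renyiDiv_lt [Nonempty X] (hα : α = 0 ∨ 1 ≤ α) (h : renyiCapacity α W < t) :
    ∃ Q : PMF Y, ∀ x, renyiDiv α (W x) Q < t := by
  rcases order_cases α with rfl | rfl | rfl | ⟨a, ha, ha', rfl⟩
  · exact exists_forall_renyiDiv_lt_zero h
  · exact exists_forall_renyiDiv_lt_one h
  · exact exists_forall_renyiDiv_lt_top h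
  · have ha1 : 1 ≤ a := by simpa [ha.not_ge] using hα
    exact exists_forall_renyiDiv_lt_of_one_lt (ha1.lt_of_ne' ha') h

end InformationRadius

section Achievability

section Approximation

theorem exists_truncation {B : Type*} [Finite B] (V Q : PMF B) (c : ℝ≥0∞) :
    ∃ L : PMF B, (∀ y, L y ≤ (c + 1) * Q y) ∧ ∀ y, min (V y) (c * Q y) ≤ L y := by
  have := Fintype.ofFinite B
  have hle : ∑ y, min (V y) (c * Q y) ≤ 1 :=
    (Finset.sum_le_sum fun y _ => min_le_left _ _).trans (sum_pmf_coe V).le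
  refine ⟨PMF.ofFintype (fun y => min (V y) (c * Q y) + (1 - ∑ y, min (V y) (c * Q y)) * Q y) ?_,
    fun y => ?_, fun y => ?_⟩
  · rw [Finset.sum_add_distrib, ← Finset.mul_sum, sum_pmf_coe, mul_one, add_tsub_cancel_of_le hle]
  · rw [PMF.ofFintype_apply, add_mul]
    gcongr
    · exact min_le_right _ _
    · exact tsub_le_self
  · rw [PMF.ofFintype_apply]
    exact le_self_add

variable {B : Type*} [Fintype B] {V Q : PMF B}

theorem exists_le_and_fidelity_zero_eq_one (h : fidelity 0 V Q ≠ 0) :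
    ∃ L : PMF B, (∀ y, L y ≤ (fidelity 0 V Q)⁻¹ * Q y) ∧ fidelity 0 V L = 1 := by
  rw [fidelity_zero] at h ⊢
  obtain ⟨y, -, hy⟩ := Finset.exists_ne_zero_of_sum_ne_zero h
  have hs : ∃ y ∈ Function.support V, y ∈ Q.support :=
    ⟨y, Set.indicator_apply_ne_zero.1 hy⟩
  refine ⟨Q.filter _ hs, fun y => ?_, ?_⟩
  · rw [PMF.filter_apply, tsum_fintype, mul_comm]
    gcongr
    exact Set.indicator_le_self _ _ y
  · rw [fidelity_zero, Set.indicator_eq_self.2, sum_pmf_coe]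
    exact fun y hy => ((PMF.mem_support_filter_iff hs).1 hy).1

theorem hellingerSum_le_one_add {L : B → ℝ≥0∞} {a : ℝ} (ha : 1 < a) {c : ℝ≥0∞} (hc : c ≠ ∞)
    (hL : ∀ y, min (V y) (c * Q y) ≤ L y) :
    hellingerSum a V L ≤ 1 + c ^ (1 - a) * hellingerSum a V Q := by
  have ha0 : 0 < a := zero_lt_one.trans ha
  have ha1 : 1 - a ≤ 0 := sub_nonpos.2 ha.le
  have hterm (y : B) :
      V y ^ a * L y ^ (1 - a) ≤ V y + c ^ (1 - a) * (V y ^ a * Q y ^ (1 - a)) := by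
    rcases min_le_iff.1 (hL y) with h | h
    · refine le_add_right ?_
      by_cases hV : V y = 0
      · simp [hV, ENNReal.zero_rpow_of_pos ha0]
      calc V y ^ a * L y ^ (1 - a) ≤ V y ^ a * V y ^ (1 - a) :=
            mul_le_mul_right (rpow_le_rpow_of_nonpos h ha1) _
        _ = V y := by rw [← ENNReal.rpow_add _ _ hV (V.apply_ne_top y)]; simp
    · refine le_add_left ?_
      calc V y ^ a * L y ^ (1 - a) ≤ V y ^ a * (c * Q y) ^ (1 - a) :=
            mul_le_mul_right (rpow_le_rpow_of_nonpos h ha1) _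
        _ = c ^ (1 - a) * (V y ^ a * Q y ^ (1 - a)) := by
            rw [ENNReal.mul_rpow_of_ne_top hc (Q.apply_ne_top y), mul_left_comm]
  calc hellingerSum a V L ≤ ∑ y, (V y + c ^ (1 - a) * (V y ^ a * Q y ^ (1 - a))) :=
        Finset.sum_le_sum fun y _ => hterm y
    _ = 1 + c ^ (1 - a) * hellingerSum a V Q := by
        rw [Finset.sum_add_distrib, sum_pmf_coe, ← Finset.mul_sum, hellingerSum]

end Approximation

variable {X Y : Type*} [Fintype X] [Fintype Y] {α : ℝ≥0∞} {W : Channel X Y} {Q : PMF Y} {t : ℝ}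

theorem rpow_le_fidelity_joint {a : ℝ} (ha : 1 < a) {M : Channel X Y} {s : ℝ≥0∞}
    (hs : ∀ x, hellingerSum a (W x) (M x) ≤ s) (P : PMF X) :
    s ^ (1 / (1 - a)) ≤ fidelity (ENNReal.ofReal a) (joint P W) (joint P M) := by
  have ha0 : 0 < a := zero_lt_one.trans ha
  rw [fidelity_ofReal ha0 ha.ne', hellingerSum_joint P W M ha0]
  refine rpow_le_rpow_of_nonpos ?_ (one_div_nonpos.2 (sub_nonpos.2 ha.le))
  calc ∑ x, P x * hellingerSum a (W x) (M x) ≤ ∑ x, P x * s := by gcongr with x; exact hs x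
    _ = s := by rw [← Finset.sum_mul, sum_pmf_coe, one_mul]

theorem pos_of_renyiDiv_lt {P : PMF Y} (h : renyiDiv α P Q < t) : 0 < t := by
  exact_mod_cast (renyiDiv_nonneg α (sum_pmf_coe P) (sum_pmf_coe Q)).trans_lt h

variable [Nonempty X]

theorem renyiSimulationRate_zero_le_of_forall_renyiDiv_lt (hQ : ∀ x, renyiDiv 0 (W x) Q < t) :
    renyiSimulationRate 0 W ≤ t := by
  have ht := pos_of_renyiDiv_lt (hQ (Classical.arbitrary X))
  have hmass (n : ℕ) (x : Fin n → X) : 2 ^ (-(n * t)) ≤ fidelity 0 (W.power n x) (iid Q n) :=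
    calc (2 : ℝ≥0∞) ^ (-(n * t)) = ∏ _i : Fin n, 2 ^ (-t) := by
          rw [neg_mul_eq_mul_neg, mul_comm, ENNReal.rpow_mul_natCast]; simp
      _ ≤ ∏ i, fidelity 0 (W (x i)) Q :=
          Finset.prod_le_prod' fun i _ => (renyiDiv_lt_iff.1 (hQ (x i))).le
      _ = fidelity 0 (W.power n x) (iid Q n) :=
          (fidelity_zero_pi (fun i => W (x i)) fun _ => Q).symm
  choose L hL hfid using fun (n : ℕ) (x : Fin n → X) =>
    exists_le_and_fidelity_zero_eq_one ((two_rpow_pos _).trans_le (hmass n x)).ne'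
  refine renyiSimulationRate_le_of_forall ht.le (iid Q) L (fun n x y => (hL n x y).trans ?_)
    tendsto_const_nhds fun n P => ?_
  · gcongr
    calc (fidelity 0 (W.power n x) (iid Q n))⁻¹ ≤ 2 ^ (n * t) := by
          rw [ENNReal.inv_le_iff_inv_le, ← ENNReal.rpow_neg]
          exact hmass n x
      _ ≤ 2 ^ (1 + n * t) := two_rpow_le_two_rpow_iff.2 (by linarith)
  · simp only [fidelity_zero_joint, hfid, mul_one, sum_pmf_coe, le_refl]

theorem renyiSimulationRate_top_le_of_forall_renyiDiv_lt (hQ : ∀ x, renyiDiv ∞ (W x) Q < t) :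
    renyiSimulationRate ∞ W ≤ t := by
  have ht := pos_of_renyiDiv_lt (hQ (Classical.arbitrary X))
  have hWQ (x : X) (y : Y) : W x y ≤ 2 ^ t * Q y :=
    calc W x y = 2 ^ t * (2 ^ (-t) * W x y) := by
          rw [← mul_assoc, ← two_rpow_add, add_neg_cancel, ENNReal.rpow_zero, one_mul]
      _ ≤ 2 ^ t * (fidelity ∞ (W x) Q * W x y) := by
          gcongr
          exact (renyiDiv_lt_iff.1 (hQ x)).le
      _ ≤ 2 ^ t * Q y := by
          gcongr
          exact fidelity_top_mul_le ((W x).apply_ne_top y)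
  refine renyiSimulationRate_le_of_forall ht.le (iid Q) W.power (fun n x y => ?_)
    tendsto_const_nhds fun n P => ?_
  · calc W.power n x y ≤ ∏ i, (2 ^ t * Q (y i)) := Finset.prod_le_prod' fun i _ => hWQ (x i) (y i)
      _ = 2 ^ (n * t) * iid Q n y := by
          rw [Finset.prod_mul_distrib, iid_apply, mul_comm (n : ℝ), ENNReal.rpow_mul_natCast]
          simp
      _ ≤ 2 ^ (1 + n * t) * iid Q n y :=
          mul_le_mul_left (two_rpow_le_two_rpow_iff.2 (by linarith)) _
  · rw [fidelity_top]
    exact le_iInf₂ fun p hp => (ENNReal.div_self hp (joint_ne_top _ _ _)).ge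

theorem renyiSimulationRate_ofReal_le_of_forall_renyiDiv_lt {a : ℝ} (ha : 1 < a)
    (hQ : ∀ x, renyiDiv (ENNReal.ofReal a) (W x) Q < t) :
    renyiSimulationRate (ENNReal.ofReal a) W ≤ t := by
  have ht := pos_of_renyiDiv_lt (hQ (Classical.arbitrary X))
  have ha0 : 0 < a := zero_lt_one.trans ha
  set s := Finset.univ.sup fun x => hellingerSum a (W x) Q
  have hs (x : X) : hellingerSum a (W x) Q ≤ s :=
    Finset.le_sup (f := fun x => hellingerSum a (W x) Q) (Finset.mem_univ x)
  have hst : s < 2 ^ ((a - 1) * t) := (Finset.sup_lt_iff (two_rpow_pos _)).2 fun x _ => by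
    rw [← lt_rpow_one_div_one_sub_iff ha, ← fidelity_ofReal ha0 ha.ne']
    exact renyiDiv_lt_iff.1 (hQ x)
  set ε := 2 ^ ((1 - a) * t) * s
  have hε : ε < 1 :=
    calc ε < 2 ^ ((1 - a) * t) * 2 ^ ((a - 1) * t) :=
          ENNReal.mul_lt_mul_right (two_rpow_pos _).ne' (two_rpow_ne_top _) hst
      _ = 1 := by rw [← two_rpow_add]; ring_nf; exact ENNReal.rpow_zero
  choose L hL hL' using fun (n : ℕ) (x : Fin n → X) =>
    exists_truncation (W.power n x) (iid Q n) (2 ^ (n * t))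
  refine renyiSimulationRate_le_of_forall ht.le (iid Q) L (fun n x y => (hL n x y).trans ?_)
    (θ := fun n => (1 + ε ^ n) ^ (1 / (1 - a))) ?_
    fun n P => rpow_le_fidelity_joint ha (fun x => ?_) P
  · gcongr
    rw [two_rpow_add, ENNReal.rpow_one, two_mul]
    gcongr
    simpa using two_rpow_le_two_rpow_iff.2 (show 0 ≤ n * t by positivity)
  · have hbase := (ENNReal.tendsto_pow_atTop_nhds_zero_of_lt_one hε).const_add 1
    exact (ENNReal.continuous_rpow_const.tendsto' _ _ (by simp)).comp hbase
  · refine (hellingerSum_le_one_add ha (two_rpow_ne_top _) (hL' n x)).trans ?_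
    gcongr
    calc (2 ^ (n * t)) ^ (1 - a) * hellingerSum a (W.power n x) (iid Q n)
        = (2 ^ ((1 - a) * t)) ^ n * ∏ i, hellingerSum a (W (x i)) Q := by
          rw [← hellingerSum_pi (fun i => W (x i)) (fun _ => Q.apply_ne_top) ha0,
            ← ENNReal.rpow_mul, ← ENNReal.rpow_mul_natCast, mul_right_comm, mul_comm (1 - a),
            mul_assoc, mul_comm t, mul_comm (n : ℝ)]
          rfl
      _ ≤ (2 ^ ((1 - a) * t)) ^ n * ∏ _i : Fin n, s := by gcongr with i; exact hs (x i)
      _ = ε ^ n := by simp [ε, mul_pow]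

theorem renyiSimulationRate_le_of_forall_renyiDiv_lt (hα : α = 0 ∨ 1 < α)
    (hQ : ∀ x, renyiDiv α (W x) Q < t) : renyiSimulationRate α W ≤ t := by
  rcases order_cases α with rfl | rfl | rfl | ⟨a, ha, -, rfl⟩
  · exact renyiSimulationRate_zero_le_of_forall_renyiDiv_lt hQ
  · simp at hα
  · exact renyiSimulationRate_top_le_of_forall_renyiDiv_lt hQ
  · have ha1 : 1 < a := by simpa [ha.not_ge] using hα
    exact renyiSimulationRate_ofReal_le_of_forall_renyiDiv_lt ha1 hQ

theorem renyiSimulationRate_le_renyiCapacity (hα : α = 0 ∨ 1 < α) (W : Channel X Y) :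
    renyiSimulationRate α W ≤ renyiCapacity α W := by
  refine EReal.le_of_forall_lt_iff_le.1 fun t ht => ?_
  obtain ⟨Q, hQ⟩ := exists_forall_renyiDiv_lt (hα.imp_right le_of_lt) ht
  exact renyiSimulationRate_le_of_forall_renyiDiv_lt hα hQ

theorem renyiSimulationRate_le_shannonCapacity (hα : 0 < α) (hα' : α ≤ 1) (W : Channel X Y) :
    renyiSimulationRate α W ≤ shannonCapacity W := by
  refine EReal.le_of_forall_lt_iff_le.1 fun t ht => ?_
  obtain ⟨Q, hQ⟩ := exists_forall_renyiDiv_lt (α := 1) (.inr le_rfl)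
    ((renyiCapacity_one_le_shannonCapacity W).trans_lt ht)
  have hev : ∀ᶠ b in 𝓝[>] (1 : ℝ), ∀ x, renyiDiv (ENNReal.ofReal b) (W x) Q < t :=
    eventually_all.2 fun x => nhdsGT_le_nhdsNE 1
      (eventually_renyiDiv_lt (sum_pmf_coe (W x)) Q.apply_ne_top (hQ x))
  obtain ⟨b, hb, hb1 : 1 < b⟩ := (hev.and self_mem_nhdsWithin).exists
  calc renyiSimulationRate α W
      ≤ renyiSimulationRate 1 W := renyiSimulationRate_le_rate_one hα hα' W
    _ ≤ renyiSimulationRate (ENNReal.ofReal b) W := renyiSimulationRate_one_le hb1 W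
    _ ≤ t := renyiSimulationRate_ofReal_le_of_forall_renyiDiv_lt hb1 hb

end Achievability

end ReverseShannon

end

theorem theorem1 {X Y : Type*} [Fintype X] [Nonempty X] [Fintype Y]
    (W : ReverseShannon.Channel X Y) (α : ENNReal) :
    (0 < α ∧ α ≤ 1 →
      ReverseShannon.renyiSimulationRate α W = ReverseShannon.shannonCapacity W) ∧
    (α = 0 ∨ 1 < α →
      ReverseShannon.renyiSimulationRate α W = ReverseShannon.renyiCapacity α W) := by
  refine ⟨fun h => le_antisymm (ReverseShannon.renyiSimulationRate_le_shannonCapacity h.1 h.2 W)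
      (ReverseShannon.shannonCapacity_le_renyiSimulationRate h.1 h.2 W),
    fun h => le_antisymm (ReverseShannon.renyiSimulationRate_le_renyiCapacity h W)
      (ReverseShannon.renyiCapacity_le_renyiSimulationRate ?_ W)⟩
  rintro rfl
  simp at h
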